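/- Let $H$ be a real or complex Hilbert space, and let $G=\prod_{i=1}^{d}s_i\mathbb Z\times\prod_{k=1}^{e}\mathbb Z_{n_k}$ with $d\ge 1$, $e\ge 0$, $s_i>0$, $n_k\ge 1$. For $g=(s_1m_1,\dots,s_dm_d,z_1,\dots,z_e)\in G$ put $|g|=\sup\{|s_1m_1|,\dots,|s_dm_d|,\delta(z_1),\dots,\delta(z_e)\}$, where $\delta(z)=0$ if $z=0$ and $\delta(z)=1$ otherwise. For $j\in G$ and an integer $N\ge 0$ let $S_N(j)=\{k\in G:|k-j|\le N/2\}$. For an index set $I$ and a map $a:I\to G$ let $I_N(j)=a^{-1}(S_N(j))$ and $$D^-(I,a)=\liminf_{N\to\infty}\inf_{j\in G}\frac{|I_N(j)|}{|S_N(j)|},\qquad D^+(I,a)=\limsup_{N\to\infty}\sup_{j\in G}\frac{|I_N(j)|}{|S_N(j)|}.$$ For $J\subset I$ write $D^\pm(J,a)=D^\pm(J,a|_J)$. A family $\mathcal F=\{f_i\}_{i\in I}$ in a closed subspace $K$ of $H$ is a frame for $K$ with frame bounds $A,B>0$ if $A\|x\|^2\le\sum_{i\in I}|\langle x,f_i\rangle|^2\le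 B\|x\|^2$ for all $x\in K$. If $\mathcal F$ is a frame for $H$, its frame operator is $Sx=\sum_i\langle x,f_i\rangle f_i$, its canonical dual frame is $\tilde f_i=S^{-1}f_i$, and (relative to $a$) $$\mathcal M^+(\mathcal F)=\limsup_{N\to\infty}\sup_{j\in G}\frac1{|I_N(j)|}\sum_{i\in I_N(j)}\langle f_i,\tilde f_i\rangle.$$ For a frame $\mathcal E=\{e_j\}_{j\in G}$ for $H$, $\mathcal M^+(\mathcal E)$ is defined in the same way with the identity map $G\to G$ in place of $a$. Let $\mathcal F=\{f_i\}_{i\in I}$ and $\mathcal E=\{e_j\}_{j\in G}$ be frames for $H$, let $A,B$ be frame bounds for $\mathcal F$, and let $a:I\to G$ be a map. Assume: (a) $0<D^-(I,a)\le D^+(I,a)<\infty$; (b) $(\mathcal F,a)$ is $\ell^1$-localized with respect to its canonical dual frame, i.e. there is $r\in\ell^1(G)$ with $|\langle f_i,\tilde f_j\rangle|\le r_{a(i)-a(j)}$ for all $i,j\in I$; (c) $(\mathcal F,a,\mathcal E)$ has $\ell^2$-column decay and $\ell^2$-row decay, i.e. for every $\varepsilon>0$ there is an integer $N>0$ with $\sum_{i\in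 I\setminus I_N(j)}|\langle f_i,e_j\rangle|^2<\varepsilon$ for all $j\in G$, and for every $\varepsilon>0$ there is an integer $N>0$ with $\sum_{j\in G\setminus S_N(a(i))}|\langle f_i,e_j\rangle|^2<\varepsilon$ for all $i\in I$; (d) $\mathcal M^+(\mathcal E)<D^-(I,a)$. Then $\mathcal M^+(\mathcal F)<1$, and there is a subset $J\subset I$ such that $D^+(J,a)=D^-(J,a)>0$ and $\{f_i\}_{i\in I\setminus J}$ is a frame for $\overline{\mathrm{span}}(\mathcal F)$ $(=H)$. Moreover, if $\mathcal M^+(\mathcal F)<\alpha<1$ and $J_\alpha=\{i\in I:\langle f_i,\tilde f_i\rangle\le\alpha\}$, then for each $0<\varepsilon<1-\alpha$ there is a subset $J\subset J_\alpha$ such that $D^+(J,a)=D^-(J,a)>0$ and $\{f_i\}_{i\in I\setminus J}$ is a frame for $\overline{\mathrm{span}}(\mathcal F)$ with frame bounds $A(1-\alpha-\varepsilon)$, $B$. Finally, if (a)--(c) hold and $\mathcal E$ is a Riesz basis for $H$ (the image of an orthonormal basis under a continuous invertible linear map), then (d) holds if and only if $D^-(I,a)>1$. -/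

import Mathlib

open Filter
open scoped ENNReal

noncomputable section

namespace FrameDensity

/-- The reference group `G = ∏ᵢ sᵢ ℤ × ∏ₖ ℤ_{nₖ}`.  An element `sᵢ m` of `sᵢ ℤ` is represented by
the integer `m`; the step sizes `sᵢ > 0` enter through the metric, see `gNorm`. -/
abbrev RefGroup (d e : ℕ) (n : Fin e → ℕ) : Type :=
  (Fin d → ℤ) × ((k : Fin e) → ZMod (n k))

section Group

variable {d e : ℕ} {n : Fin e → ℕ}

/-- `|g| = sup {|s₁ m₁|, …, |s_d m_d|, δ(z₁), …, δ(z_e)}` for `g = (s₁ m₁, …, s_d m_d, z₁, …, z_e)`,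
where `δ(z) = 0` if `z = 0` and `δ(z) = 1` otherwise.  The metric of `G` is `|g - h|`. -/
def gNorm (s : Fin d → ℝ) (g : RefGroup d e n) : ℝ :=
  max (⨆ i, |s i * (g.1 i : ℝ)|) (⨆ k, if g.2 k = 0 then (0 : ℝ) else 1)

/-- The box `S_N(j) = {k ∈ G : |k - j| ≤ N / 2}`. -/
def box (s : Fin d → ℝ) (N : ℕ) (j : RefGroup d e n) : Set (RefGroup d e n) :=
  {k | gNorm s (k - j) ≤ (N : ℝ) / 2}

/-- `I_N(j) = a⁻¹(S_N(j))`. -/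
def preBox {I : Type*} (s : Fin d → ℝ) (a : I → RefGroup d e n) (N : ℕ) (j : RefGroup d e n) :
    Set I :=
  a ⁻¹' box s N j

/-- The lower density `D⁻(I, a)`. -/
def lowerDensity {I : Type*} (s : Fin d → ℝ) (a : I → RefGroup d e n) : ℝ≥0∞ :=
  liminf (fun N : ℕ => ⨅ j : RefGroup d e n,
    ((preBox s a N j).encard : ℝ≥0∞) / ((box s N j).encard : ℝ≥0∞)) atTop

/-- The upper density `D⁺(I, a)`. -/
def upperDensity {I : Type*} (s : Fin d → ℝ) (a : I → RefGroup d e n) : ℝ≥0∞ :=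
  limsup (fun N : ℕ => ⨆ j : RefGroup d e n,
    ((preBox s a N j).encard : ℝ≥0∞) / ((box s N j).encard : ℝ≥0∞)) atTop

end Group

section Frames

variable (𝕜 : Type*) [RCLike 𝕜] {H : Type*} [NormedAddCommGroup H] [InnerProductSpace 𝕜 H]
  {I : Type*}

/-- `f` is a frame for the subspace `K` with frame bounds `A`, `B`: the `f i` lie in `K` and
`A ‖x‖² ≤ ∑ᵢ |⟨x, fᵢ⟩|² ≤ B ‖x‖²` for all `x ∈ K` (in particular the series converges). -/
def IsFrameForWith (K : Submodule 𝕜 H) (f : I → H) (A B : ℝ) : Prop :=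
  0 < A ∧ 0 < B ∧ (∀ i, f i ∈ K) ∧
    ∀ x ∈ K, Summable (fun i => ‖inner 𝕜 (f i) x‖ ^ 2) ∧
      A * ‖x‖ ^ 2 ≤ ∑' i, ‖inner 𝕜 (f i) x‖ ^ 2 ∧
      ∑' i, ‖inner 𝕜 (f i) x‖ ^ 2 ≤ B * ‖x‖ ^ 2

/-- `f` is a frame for the subspace `K`. -/
def IsFrameFor (K : Submodule 𝕜 H) (f : I → H) : Prop :=
  ∃ A B : ℝ, IsFrameForWith 𝕜 K f A B

/-- The closed linear span of a family. -/
def closedSpan (f : I → H) : Submodule 𝕜 H :=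
  (Submodule.span 𝕜 (Set.range f)).topologicalClosure

/-- The frame operator `S x = ∑ᵢ ⟨x, fᵢ⟩ fᵢ`; Mathlib's inner product is conjugate-linear in its
first argument, so `⟨x, fᵢ⟩` is `inner 𝕜 (f i) x`. -/
def frameOperator (f : I → H) (x : H) : H :=
  ∑' i, inner 𝕜 (f i) x • f i

/-- The canonical dual `S⁻¹ fᵢ` of a frame for `H`.  For such a frame `S` is a bijection of `H`,
and `Function.invFun` is its inverse. -/
def canonicalDual (f : I → H) (i : I) : H :=
  Function.invFun (frameOperator 𝕜 f) (f i)

/-- The (real) number `⟨fᵢ, S⁻¹ fᵢ⟩`, which lies in `[0, 1]` if `f` is a frame for `H`. -/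
def dualDiag (f : I → H) (i : I) : ℝ :=
  RCLike.re (inner 𝕜 (canonicalDual 𝕜 f i) (f i))

/-- A Riesz basis of `H`: the image of an orthonormal basis under a continuous linear bijection
(whose inverse is automatically continuous if `H` is complete). -/
def IsRieszBasis (f : I → H) : Prop :=
  ∃ (b : HilbertBasis I 𝕜 H) (T : H ≃L[𝕜] H), ∀ i, f i = T (b i)

variable {d e : ℕ} {n : Fin e → ℕ}

/-- The upper measure `M⁺(F) = limsup_N sup_j |I_N(j)|⁻¹ ∑_{i ∈ I_N(j)} ⟨fᵢ, S⁻¹ fᵢ⟩` of a frame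
`F` for `H`.  The terms are nonnegative, so the sum is taken in `[0, ∞]`. -/
def upperMeasure (s : Fin d → ℝ) (a : I → RefGroup d e n) (f : I → H) : ℝ≥0∞ :=
  limsup (fun N : ℕ => ⨆ j : RefGroup d e n,
    (∑' i : preBox s a N j, ENNReal.ofReal (dualDiag 𝕜 f i)) /
      ((preBox s a N j).encard : ℝ≥0∞)) atTop

/-- `(F, a)` is `ℓ¹`-localized with respect to its canonical dual frame. -/
def IsL1LocalizedDual (a : I → RefGroup d e n) (f : I → H) : Prop :=
  ∃ r : RefGroup d e n → ℝ, Summable r ∧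
    ∀ i j : I, ‖inner 𝕜 (canonicalDual 𝕜 f j) (f i)‖ ≤ r (a i - a j)

/-- `(F, a, E)` has `ℓ²`-column decay. -/
def HasL2ColumnDecay (s : Fin d → ℝ) (a : I → RefGroup d e n) (f : I → H)
    (E : RefGroup d e n → H) : Prop :=
  ∀ ε : ℝ, 0 < ε → ∃ N : ℕ, 0 < N ∧ ∀ j : RefGroup d e n,
    ∑' i : ((preBox s a N j)ᶜ : Set I), ‖inner 𝕜 (E j) (f i)‖ₑ ^ 2 < ENNReal.ofReal ε

/-- `(F, a, E)` has `ℓ²`-row decay. -/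
def HasL2RowDecay (s : Fin d → ℝ) (a : I → RefGroup d e n) (f : I → H)
    (E : RefGroup d e n → H) : Prop :=
  ∀ ε : ℝ, 0 < ε → ∃ N : ℕ, 0 < N ∧ ∀ i : I,
    ∑' j : ((box s N (a i))ᶜ : Set (RefGroup d e n)), ‖inner 𝕜 (E j) (f i)‖ₑ ^ 2
      < ENNReal.ofReal ε

end Frames

end FrameDensity

end

/-! The sum of `⟨fᵢ, f̃ᵢ⟩` over a large box is compared with that of `⟨eⱼ, ẽⱼ⟩`. Both diagonals are
marginals of one matrix, the real parts of `⟨f̃ᵢ, ẽⱼ⟩⟨eⱼ, fᵢ⟩`: summing over `j` gives the first,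
over `i` the second. Row and column decay keep all but a small part of each marginal inside the box,
except near its boundary, which is negligible (`eventually_sum_dualDiag_le`). Since a box holds at
least about `D⁻(I, a)` indices per group element, the average of `⟨fᵢ, f̃ᵢ⟩` stays below a constant
less than `1`.

If `M⁺(F) < α`, every box of some fixed size contains an index with `⟨fᵢ, f̃ᵢ⟩ ≤ α`. Choosing one
near each point of a coarse sublattice gives a set `J` of uniform positive density whose points are
as far apart as desired (`exists_sparse_subset`). By `ℓ¹`-localization the matrix `⟨fᵢ, f̃ⱼ⟩` on `J`
then has diagonal at most `α` and off-diagonal row and column sums at most `ε`. A Schur test shows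
that `J` carries at most the fraction `α + ε` of `∑ᵢ |⟨x, fᵢ⟩|²`, so the complement keeps the rest
(`IsFrameForWith.compl_of_offDiag_le`).

A Riesz basis is biorthogonal to its canonical dual, hence has upper measure `1`; this turns (d)
into `D⁻(I, a) > 1`. -/

namespace FrameDensity

/-! ### Frame operators, canonical duals and removal of elements -/

section FrameTheory

variable {𝕜 : Type*} [RCLike 𝕜] {H : Type*} [NormedAddCommGroup H] [InnerProductSpace 𝕜 H]
  {I : Type*} {f : I → H} {A B : ℝ}

theorem IsFrameForWith.summable (hf : IsFrameForWith 𝕜 ⊤ f A B) (x : H) :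
    Summable (fun i => ‖inner 𝕜 (f i) x‖ ^ 2) :=
  (hf.2.2.2 x trivial).1

/-- The analysis operator `x ↦ (⟨x, fᵢ⟩)ᵢ` of a frame. -/
theorem IsFrameForWith.exists_analysis (hf : IsFrameForWith 𝕜 ⊤ f A B) :
    ∃ C : H →L[𝕜] lp (fun _ : I => 𝕜) 2, (∀ x i, C x i = inner 𝕜 (f i) x) ∧
      ∀ x, ‖C x‖ ^ 2 = ∑' i, ‖inner 𝕜 (f i) x‖ ^ 2 := by
  have hmem : ∀ x : H, Memℓp (fun i => inner 𝕜 (f i) x) 2 := fun x =>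
    memℓp_gen (by simpa using hf.summable x)
  let L : H →ₗ[𝕜] lp (fun _ : I => 𝕜) 2 :=
    { toFun := fun x => ⟨fun i => inner 𝕜 (f i) x, hmem x⟩
      map_add' := fun x y => by ext i; exact inner_add_right _ _ _
      map_smul' := fun c x => by ext i; exact inner_smul_right _ _ _ }
  have hL : ∀ x, ‖L x‖ ^ 2 = ∑' i, ‖inner 𝕜 (f i) x‖ ^ 2 := fun x => by
    have := lp.norm_rpow_eq_tsum (p := 2) (by simp) (L x)
    simp only [ENNReal.toReal_ofNat, Real.rpow_ofNat] at this
    exact this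
  refine ⟨L.mkContinuous (Real.sqrt B) fun x => ?_, fun x i => rfl, hL⟩
  refine le_of_sq_le_sq ?_ (by positivity)
  rw [hL, mul_pow, Real.sq_sqrt hf.2.1.le]
  exact (hf.2.2.2 x trivial).2.2

/-- The frame operator of a frame for the whole space is a continuous linear bijection `S = C⋆ C`,
where `C` is the analysis operator, and the canonical dual frame is `S⁻¹ fᵢ`. -/
theorem IsFrameForWith.exists_frameOperator [CompleteSpace H] (hf : IsFrameForWith 𝕜 ⊤ f A B) :
    ∃ (C : H →L[𝕜] lp (fun _ : I => 𝕜) 2) (S : H ≃L[𝕜] H),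
      (∀ x i, C x i = inner 𝕜 (f i) x) ∧
      (∀ x, ‖C x‖ ^ 2 = ∑' i, ‖inner 𝕜 (f i) x‖ ^ 2) ∧
      (∀ x y, inner 𝕜 (S x) y = inner 𝕜 (C x) (C y)) ∧
      (∀ x, HasSum (fun i => inner 𝕜 (f i) x • f i) (S x)) ∧
      (∀ i, canonicalDual 𝕜 f i = S.symm (f i)) := by
  classical
  obtain ⟨C, hC, hCn⟩ := hf.exists_analysis
  let S₀ : H →L[𝕜] H := (ContinuousLinearMap.adjoint C).comp C
  have hS₀ : ∀ x y, inner 𝕜 (S₀ x) y = inner 𝕜 (C x) (C y) := fun x y =>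
    ContinuousLinearMap.adjoint_inner_left C _ _
  -- The lower frame bound makes `S₀` coercive, hence invertible.
  have hunit : IsUnit S₀ := by
    refine ContinuousLinearMap.isUnit_of_forall_le_norm_inner_map S₀ (c := ⟨A, hf.1.le⟩) hf.1
      fun x => ?_
    rw [hS₀, inner_self_eq_norm_sq_to_K, norm_pow, RCLike.norm_ofReal, abs_norm, hCn, mul_comm]
    exact (hf.2.2.2 x trivial).2.1
  obtain ⟨u, hu⟩ := hunit
  let S : H ≃L[𝕜] H := ContinuousLinearEquiv.ofUnit u
  have hSS : ∀ x, S x = S₀ x := fun x => by rw [← hu]; rfl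
  have hadj : ∀ i (c : 𝕜), ContinuousLinearMap.adjoint C (lp.single 2 i c) = c • f i := by
    intro i c
    refine ext_inner_right 𝕜 fun y => ?_
    rw [ContinuousLinearMap.adjoint_inner_left, lp.inner_single_left, hC, inner_smul_left]
    simp [mul_comm]
  have hsum : ∀ x, HasSum (fun i => inner 𝕜 (f i) x • f i) (S x) := by
    intro x
    have h := (lp.hasSum_single (by simp) (C x)).mapL (ContinuousLinearMap.adjoint C)
    simp only [hadj, hC] at h
    rw [hSS]
    exact h
  have hfo : frameOperator 𝕜 f = S := funext fun x => (hsum x).tsum_eq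
  refine ⟨C, S, hC, hCn, fun x y => by rw [hSS, hS₀], hsum, fun i => ?_⟩
  rw [canonicalDual, hfo]
  apply S.injective
  rw [S.apply_symm_apply]
  exact Function.invFun_eq (S.surjective _)

/-- The facts about the canonical dual that are used below: it is a bounded family, it is Bessel,
it reproduces inner products, and `⟨fᵢ, S⁻¹fᵢ⟩ ≥ 0`. -/
theorem IsFrameForWith.canonicalDual_spec [CompleteSpace H] (hf : IsFrameForWith 𝕜 ⊤ f A B) :
    (∀ x y, HasSum (fun i => inner 𝕜 (canonicalDual 𝕜 f i) y * inner 𝕜 x (f i)) (inner 𝕜 x y)) ∧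
    (∀ i, 0 ≤ dualDiag 𝕜 f i) ∧
    ∃ D : ℝ, 0 < D ∧ (∀ i, ‖f i‖ ^ 2 ≤ D) ∧ (∀ i, ‖canonicalDual 𝕜 f i‖ ^ 2 ≤ D) ∧
      ∀ y, Summable (fun i => ‖inner 𝕜 (canonicalDual 𝕜 f i) y‖ ^ 2) ∧
        ∑' i, ‖inner 𝕜 (canonicalDual 𝕜 f i) y‖ ^ 2 ≤ D * ‖y‖ ^ 2 := by
  obtain ⟨C, S, hC, hCn, hS, hsum, hd⟩ := hf.exists_frameOperator
  have hsymm : ∀ x y, inner 𝕜 (S x) y = inner 𝕜 x (S y) := fun x y => by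
    rw [hS, ← inner_conj_symm x, hS, inner_conj_symm]
  have hdi : ∀ i y, inner 𝕜 (canonicalDual 𝕜 f i) y = inner 𝕜 (f i) (S.symm y) := fun i y => by
    rw [hd]
    conv_lhs => rw [← S.apply_symm_apply y]
    rw [← hsymm, S.apply_symm_apply]
  -- Testing the upper bound on `f i` and keeping one term gives `‖f i‖⁴ ≤ B ‖f i‖²`.
  have hfB : ∀ i, ‖f i‖ ^ 2 ≤ B := fun i => by
    obtain ⟨h1, -, h2⟩ := hf.2.2.2 (f i) trivial
    have h3 := h1.le_tsum i fun _ _ => by positivity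
    have h4 : ‖inner 𝕜 (f i) (f i)‖ ^ 2 = (‖f i‖ ^ 2) ^ 2 := by
      rw [inner_self_eq_norm_sq_to_K, norm_pow, RCLike.norm_ofReal, abs_norm]
    rw [h4] at h3
    by_contra! h5
    nlinarith [hf.2.1]
  have hsn : ∀ y, ‖S.symm y‖ ^ 2 ≤ ‖(S.symm : H →L[𝕜] H)‖ ^ 2 * ‖y‖ ^ 2 := fun y => by
    rw [← mul_pow]
    gcongr
    exact (S.symm : H →L[𝕜] H).le_opNorm y
  refine ⟨fun x y => ?_, fun i => ?_, B + ‖(S.symm : H →L[𝕜] H)‖ ^ 2 * B, ?_, fun i => ?_,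
    fun i => ?_, fun y => ?_⟩
  · have h := (hsum (S.symm y)).mapL (innerSL 𝕜 x)
    simpa [inner_smul_right, hdi] using h
  · rw [dualDiag]
    have : f i = S (canonicalDual 𝕜 f i) := by rw [hd, S.apply_symm_apply]
    rw [this, ← hsymm, hS]
    exact inner_self_nonneg
  · have := hf.2.1
    positivity
  · have := hf.2.1
    have h : 0 ≤ ‖(S.symm : H →L[𝕜] H)‖ ^ 2 * B := by positivity
    linarith [hfB i]
  · have h := hsn (f i)
    rw [hd]
    have := hf.2.1
    nlinarith [hfB i, sq_nonneg ‖(S.symm : H →L[𝕜] H)‖]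
  · simp only [hdi]
    obtain ⟨h1, -, h2⟩ := hf.2.2.2 (S.symm y) trivial
    refine ⟨h1, h2.trans ?_⟩
    have := hf.2.1
    have h3 := mul_le_mul_of_nonneg_left (hsn y) this.le
    nlinarith [sq_nonneg ‖y‖]

/-- The diagonal `⟨fᵢ, S⁻¹fᵢ⟩` of a Riesz basis is identically `1`. -/
theorem IsRieszBasis.dualDiag_eq_one [CompleteSpace H] (hf : IsFrameForWith 𝕜 ⊤ f A B)
    (h : IsRieszBasis 𝕜 f) (i : I) : dualDiag 𝕜 f i = 1 := by
  classical
  obtain ⟨b, T, hT⟩ := h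
  obtain ⟨h1, -⟩ := hf.canonicalDual_spec
  have key : ∀ x, inner 𝕜 x (canonicalDual 𝕜 f i) =
      inner 𝕜 (T.symm x) (b i) := by
    intro x
    obtain ⟨C, S, hC, -, -, hsum, hd⟩ := hf.exists_frameOperator
    have hz := hsum (canonicalDual 𝕜 f i)
    rw [hd i, S.apply_symm_apply, ← hd i] at hz
    have hz' := hz.mapL (T.symm : H →L[𝕜] H)
    simp only [hT, map_smul, ContinuousLinearEquiv.coe_coe,
      ContinuousLinearEquiv.symm_apply_apply] at hz'
    -- Biorthogonality: `T⁻¹` applied to `fᵢ = ∑ₖ ⟨f̃ᵢ, fₖ⟩ fₖ` expands `b i` in the `b k`, so the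
    -- coefficients are those of `b i`.
    have hb : ∀ k, inner 𝕜 (T (b k)) (canonicalDual 𝕜 f i) = inner 𝕜 (b k) (b i) := by
      intro k
      have h2 := hz'.mapL (innerSL 𝕜 (b k))
      simp only [innerSL_apply_apply, inner_smul_right,
        orthonormal_iff_ite.mp b.orthonormal] at h2
      have h3 := h2.unique (hasSum_single k fun j hj => by rw [if_neg hj.symm, mul_zero])
      rw [orthonormal_iff_ite.mp b.orthonormal k i, h3, if_pos rfl, mul_one]
    have hx := (b.hasSum_repr (T.symm x)).mapL (T : H →L[𝕜] H)
    simp only [map_smul, ContinuousLinearEquiv.coe_coe,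
      ContinuousLinearEquiv.apply_symm_apply] at hx
    have e1 := hx.mapL (innerSL 𝕜 (canonicalDual 𝕜 f i))
    have e2 := (b.hasSum_repr (T.symm x)).mapL (innerSL 𝕜 (b i))
    simp only [innerSL_apply_apply, inner_smul_right] at e1 e2
    have hb' : ∀ k, inner 𝕜 (canonicalDual 𝕜 f i) (T (b k)) = inner 𝕜 (b i) (b k) := fun k => by
      rw [← inner_conj_symm, hb, inner_conj_symm]
    simp only [hb'] at e1
    rw [← inner_conj_symm, e1.unique e2, inner_conj_symm]
  rw [dualDiag, ← RCLike.conj_re, inner_conj_symm, key, hT, T.symm_apply_apply,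
    orthonormal_iff_ite.mp b.orthonormal]
  simp

/-- If the Gram matrix of a frame against its canonical dual has diagonal at most `α` on `J` and
off-diagonal row and column sums at most `ε` there, then `J` can be removed. -/
theorem IsFrameForWith.compl_of_offDiag_le [CompleteSpace H] (hf : IsFrameForWith 𝕜 ⊤ f A B)
    {J : Set I} {α ε : ℝ} (h0αε : 0 ≤ α + ε) (hαε : α + ε < 1)
    (hdiag : ∀ i ∈ J, dualDiag 𝕜 f i ≤ α) (ρ : I → I → ℝ)
    (hρ : ∀ i j, ‖inner 𝕜 (canonicalDual 𝕜 f j) (f i)‖ ≤ ρ i j)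
    (hrow : ∀ (F : Finset I) (i : I), ↑F ⊆ J → i ∈ J → i ∉ F → ∑ j ∈ F, ρ i j ≤ ε)
    (hcol : ∀ (F : Finset I) (j : I), ↑F ⊆ J → j ∈ J → j ∉ F → ∑ i ∈ F, ρ i j ≤ ε) :
    IsFrameForWith 𝕜 ⊤ (fun i : (Jᶜ : Set I) => f i) (A * (1 - (α + ε))) B := by
  classical
  obtain ⟨C, S, hC, hCn, hS, hsum, hd⟩ := hf.exists_frameOperator
  refine ⟨mul_pos hf.1 (by linarith), hf.2.1, fun _ => trivial, fun x _ => ?_⟩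
  obtain ⟨h1, h2, h3⟩ := hf.2.2.2 x trivial
  set c : I → 𝕜 := fun i => inner 𝕜 (f i) x with hc
  have hfin : ∀ F : Finset I, ↑F ⊆ J → ∑ i ∈ F, ‖c i‖ ^ 2 ≤ (α + ε) * ‖C x‖ ^ 2 := by
    intro F hFJ
    set t := ∑ i ∈ F, ‖c i‖ ^ 2 with ht
    -- Duality: `⟨Cz, Cx⟩ = t`, while `‖Cz‖²` is the quadratic form of the matrix `⟨fᵢ, f̃ⱼ⟩` at
    -- `c`. Once this is at most `(α + ε) t`, Cauchy–Schwarz bounds `t`.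
    set z : H := ∑ i ∈ F, c i • canonicalDual 𝕜 f i with hz
    have hSz : S z = ∑ i ∈ F, c i • f i := by
      simp [hz, hd]
    have hzx : inner 𝕜 (C z) (C x) = ((t : ℝ) : 𝕜) := by
      rw [← hS, hSz, sum_inner, ht]
      push_cast
      refine Finset.sum_congr rfl fun i _ => ?_
      rw [inner_smul_left, RCLike.conj_mul]
    have hzz : ‖C z‖ ^ 2 ≤ (α + ε) * t := by
      have e1 : ‖C z‖ ^ 2 = RCLike.re (inner 𝕜 z (S z)) := by
        rw [← inner_conj_symm, RCLike.conj_re, hS, inner_self_eq_norm_sq]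
      have e2 : inner 𝕜 z (S z) = ∑ i ∈ F, ∑ j ∈ F,
          c i * (starRingEnd 𝕜 (c j) * inner 𝕜 (canonicalDual 𝕜 f j) (f i)) := by
        rw [hSz, inner_sum]
        refine Finset.sum_congr rfl fun i _ => ?_
        rw [inner_smul_right, hz, sum_inner, Finset.mul_sum]
        simp only [inner_smul_left]
      -- Schur test: the arithmetic-geometric mean inequality splits each off-diagonal term into a
      -- half charged to row `i` and a half charged to column `j`.
      have e3 : ∀ i ∈ F, ∀ j ∈ F,
          RCLike.re (c i * (starRingEnd 𝕜 (c j) * inner 𝕜 (canonicalDual 𝕜 f j) (f i))) ≤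
            (if i = j then α * ‖c i‖ ^ 2 else 0) +
              ((if i = j then 0 else ρ i j * ‖c i‖ ^ 2 / 2) +
               (if i = j then 0 else ρ i j * ‖c j‖ ^ 2 / 2)) := by
        intro i hi j hj
        split_ifs with hij
        · subst hij
          rw [← mul_assoc, RCLike.mul_conj, ← RCLike.ofReal_pow, RCLike.re_ofReal_mul]
          have := hdiag i (hFJ hi)
          rw [dualDiag] at this
          nlinarith [sq_nonneg ‖c i‖]
        · refine (RCLike.re_le_norm _).trans ?_
          rw [norm_mul, norm_mul, RCLike.norm_conj]
          have h0 := hρ i j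
          have h5 : 0 ≤ ρ i j := (norm_nonneg _).trans h0
          have h6 : ‖c i‖ * (‖c j‖ * ‖inner 𝕜 (canonicalDual 𝕜 f j) (f i)‖) ≤
              ‖c i‖ * (‖c j‖ * ρ i j) := by gcongr
          nlinarith [mul_nonneg h5 (sq_nonneg (‖c i‖ - ‖c j‖))]
      have hr : ∀ i ∈ F, ∑ j ∈ F, (if i = j then 0 else ρ i j * ‖c i‖ ^ 2 / 2) ≤
          ε * ‖c i‖ ^ 2 / 2 := by
        intro i hi
        have h7 := hrow (F.erase i) i
          (fun k hk => hFJ (Finset.mem_of_mem_erase (Finset.mem_coe.mp hk))) (hFJ hi) (by simp)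
        calc ∑ j ∈ F, (if i = j then 0 else ρ i j * ‖c i‖ ^ 2 / 2)
            = (∑ j ∈ F.erase i, ρ i j) * ‖c i‖ ^ 2 / 2 := by
              rw [← Finset.add_sum_erase F _ hi, if_pos rfl, zero_add, Finset.sum_mul,
                Finset.sum_div]
              exact Finset.sum_congr rfl fun j hj => if_neg (Finset.ne_of_mem_erase hj).symm
          _ ≤ _ := by gcongr
      have hcl : ∀ j ∈ F, ∑ i ∈ F, (if i = j then 0 else ρ i j * ‖c j‖ ^ 2 / 2) ≤
          ε * ‖c j‖ ^ 2 / 2 := by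
        intro j hj
        have h7 := hcol (F.erase j) j
          (fun k hk => hFJ (Finset.mem_of_mem_erase (Finset.mem_coe.mp hk))) (hFJ hj) (by simp)
        calc ∑ i ∈ F, (if i = j then 0 else ρ i j * ‖c j‖ ^ 2 / 2)
            = (∑ i ∈ F.erase j, ρ i j) * ‖c j‖ ^ 2 / 2 := by
              rw [← Finset.add_sum_erase F _ hj, if_pos rfl, zero_add, Finset.sum_mul,
                Finset.sum_div]
              exact Finset.sum_congr rfl fun i hi => if_neg (Finset.ne_of_mem_erase hi)
          _ ≤ _ := by gcongr
      rw [e1, e2, map_sum]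
      simp only [map_sum]
      refine (Finset.sum_le_sum fun i hi => Finset.sum_le_sum fun j hj => e3 i hi j hj).trans ?_
      simp only [Finset.sum_add_distrib]
      have s1 : ∑ i ∈ F, ∑ j ∈ F, (if i = j then α * ‖c i‖ ^ 2 else 0) = α * t := by
        rw [ht, Finset.mul_sum]
        refine Finset.sum_congr rfl fun i hi => ?_
        simp [hi]
      have s2 := Finset.sum_le_sum hr
      have s3 := Finset.sum_le_sum hcl
      rw [Finset.sum_comm] at s3
      have s4 : ∑ i ∈ F, ε * ‖c i‖ ^ 2 / 2 = ε * t / 2 := by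
        rw [ht, Finset.mul_sum, Finset.sum_div]
      rw [s4] at s2 s3
      linarith
    have ht0 : 0 ≤ t := Finset.sum_nonneg fun _ _ => by positivity
    have hcs : t ≤ ‖C z‖ * ‖C x‖ := by
      have := norm_inner_le_norm (𝕜 := 𝕜) (C z) (C x)
      rwa [hzx, RCLike.norm_ofReal, abs_of_nonneg ht0] at this
    rcases ht0.eq_or_lt with h0 | hpos
    · rw [← h0]; positivity
    · have h8 : t ^ 2 ≤ (α + ε) * t * ‖C x‖ ^ 2 := by
        calc t ^ 2 ≤ (‖C z‖ * ‖C x‖) ^ 2 := by gcongr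
          _ = ‖C z‖ ^ 2 * ‖C x‖ ^ 2 := by ring
          _ ≤ _ := by gcongr
      nlinarith
  have hJ : ∑' i : J, ‖c i‖ ^ 2 ≤ (α + ε) * ‖C x‖ ^ 2 := by
    refine (h1.subtype J).tsum_le_of_sum_le fun F => ?_
    have h9 := hfin (F.map (Function.Embedding.subtype _)) fun i hi => by
      obtain ⟨k, -, rfl⟩ := Finset.mem_map.mp (Finset.mem_coe.mp hi)
      exact k.2
    rwa [Finset.sum_map] at h9
  have hsplit := (h1.subtype J).tsum_add_tsum_compl (h1.subtype Jᶜ)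
  rw [hCn] at hJ
  have hJ0 : 0 ≤ ∑' i : J, ‖c i‖ ^ 2 := tsum_nonneg fun _ => by positivity
  refine ⟨h1.subtype Jᶜ, ?_, ?_⟩
  · nlinarith
  · linarith

end FrameTheory

end FrameDensity

/-! ### Counting points in boxes -/

namespace FrameDensity

section Counting

open Topology

variable {d e : ℕ} {n : Fin e → ℕ}

/-- The lattice points `q ∈ ℤᵈ` with `|tᵢ qᵢ - xᵢ| ≤ ρ` for all `i`, see `mem_latticeBox`. -/
noncomputable def latticeBox (t x : Fin d → ℝ) (ρ : ℝ) : Finset (Fin d → ℤ) :=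
  Fintype.piFinset fun i => Finset.Icc ⌈(x i - ρ) / t i⌉ ⌊(x i + ρ) / t i⌋

theorem mem_latticeBox {t x : Fin d → ℝ} (ht : ∀ i, 0 < t i) {ρ : ℝ} {q : Fin d → ℤ} :
    q ∈ latticeBox t x ρ ↔ ∀ i, |t i * q i - x i| ≤ ρ := by
  simp only [latticeBox, Fintype.mem_piFinset, Finset.mem_Icc]
  refine forall_congr' fun i => ?_
  rw [Int.ceil_le, Int.le_floor, div_le_iff₀ (ht i), le_div_iff₀ (ht i), abs_le]
  constructor <;> rintro ⟨h1, h2⟩ <;> constructor <;> linarith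

/-- Rounding costs at most one point per coordinate. The hypothesis keeps the lower factors
nonnegative, so that they can be multiplied. -/
theorem card_latticeBox_bounds {t x : Fin d → ℝ} {ρ : ℝ}
    (hρ : ∀ i, 1 ≤ 2 * ρ / t i) :
    ∏ i, (2 * ρ / t i - 1) ≤ ((latticeBox t x ρ).card : ℝ) ∧
      ((latticeBox t x ρ).card : ℝ) ≤ ∏ i, (2 * ρ / t i + 1) := by
  have key : ∀ i, 2 * ρ / t i - 1 ≤
      ((Finset.Icc ⌈(x i - ρ) / t i⌉ ⌊(x i + ρ) / t i⌋).card : ℝ) ∧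
      ((Finset.Icc ⌈(x i - ρ) / t i⌉ ⌊(x i + ρ) / t i⌋).card : ℝ) ≤ 2 * ρ / t i + 1 := by
    intro i
    have h1 := Int.lt_floor_add_one ((x i + ρ) / t i)
    have h2 := Int.floor_le ((x i + ρ) / t i)
    have h3 := Int.ceil_lt_add_one ((x i - ρ) / t i)
    have h4 := Int.le_ceil ((x i - ρ) / t i)
    have h5 : 2 * ρ / t i = (x i + ρ) / t i - (x i - ρ) / t i := by ring
    have h6 : ∀ z : ℤ, ((z.toNat : ℕ) : ℝ) = max (z : ℝ) 0 := fun z => by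
      rw [← Int.cast_natCast, Int.toNat_eq_max]; push_cast; rfl
    rw [Int.card_Icc, h6]
    push_cast
    have := hρ i
    refine ⟨le_max_of_le_left ?_, max_le ?_ ?_⟩ <;> linarith
  rw [latticeBox, Fintype.card_piFinset]
  push_cast
  exact ⟨Finset.prod_le_prod (fun i _ => by linarith [hρ i]) fun i _ => (key i).1,
    Finset.prod_le_prod (fun i _ => by positivity) fun i _ => (key i).2⟩

theorem tendsto_affine_div_affine {t t' : ℝ} (ht : 0 < t) (ht' : 0 < t') (u u' : ℝ) :
    Tendsto (fun N : ℕ => ((N : ℝ) / t + u) / ((N : ℝ) / t' + u')) atTop (𝓝 (t' / t)) := by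
  have h : ∀ v w : ℝ, Tendsto (fun N : ℕ => 1 / v + w / (N : ℝ)) atTop (𝓝 (1 / v)) := fun v w => by
    simpa using (tendsto_const_nhds (x := 1 / v)).add (tendsto_const_div_atTop_nhds_zero_nat w)
  have h1 := (h t u).div (h t' u') (by positivity)
  rw [show 1 / t / (1 / t') = t' / t by field_simp] at h1
  refine h1.congr' ?_
  filter_upwards [eventually_gt_atTop 0] with N hN
  have hN' : (0 : ℝ) < N := by exact_mod_cast hN
  have e : ∀ v w : ℝ, (N : ℝ) / v + w = N * (1 / v + w / N) := fun v w => by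
    field_simp
  simp only [Pi.div_apply]
  rw [e t u, e t' u', mul_div_mul_left _ _ hN'.ne']

/-- All counting bounds have this shape; rounding errors and boundary shifts are absorbed in `u`,
`u'` and vanish in the limit. -/
theorem tendsto_prod_affine_div {t t' : Fin d → ℝ} (ht : ∀ i, 0 < t i) (ht' : ∀ i, 0 < t' i)
    (u u' : Fin d → ℝ) :
    Tendsto (fun N : ℕ => (∏ i, ((N : ℝ) / t i + u i)) / ∏ i, ((N : ℝ) / t' i + u' i)) atTop
      (𝓝 (∏ i, t' i / t i)) := by
  simp only [← Finset.prod_div_distrib]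
  exact tendsto_finsetProd _ fun i _ => tendsto_affine_div_affine (ht i) (ht' i) (u i) (u' i)

/-- A real supremum over an empty family is `0`, which is why `0 ≤ ρ` is needed. -/
theorem gNorm_le_iff {s : Fin d → ℝ} {g : RefGroup d e n} {ρ : ℝ} (hρ : 0 ≤ ρ) :
    gNorm s g ≤ ρ ↔ (∀ i, |s i * (g.1 i : ℝ)| ≤ ρ) ∧
      ∀ k, (if g.2 k = 0 then (0 : ℝ) else 1) ≤ ρ := by
  rw [gNorm, max_le_iff]
  refine and_congr ⟨fun h i => ?_, fun h => Real.iSup_le h hρ⟩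
    ⟨fun h k => ?_, fun h => Real.iSup_le h hρ⟩
  · exact (le_ciSup (f := fun i => |s i * (g.1 i : ℝ)|) (Set.finite_range _).bddAbove i).trans h
  · exact (le_ciSup (f := fun k => if g.2 k = 0 then (0 : ℝ) else 1)
      (Set.finite_range _).bddAbove k).trans h

theorem box_mono (s : Fin d → ℝ) {N N' : ℕ} (h : N ≤ N') (j : RefGroup d e n) :
    box s N j ⊆ box s N' j := by
  intro k hk
  have : (N : ℝ) ≤ N' := by exact_mod_cast h
  simp only [box, Set.mem_ofPred_eq] at hk ⊢
  linarith

/-- A box of size at least `2` contains all of the torsion part of `G`. -/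
theorem mem_box_iff {s : Fin d → ℝ} {N : ℕ} (hN : 2 ≤ N) {j k : RefGroup d e n} :
    k ∈ box s N j ↔ ∀ i, |s i * (k.1 i : ℝ) - s i * (j.1 i : ℝ)| ≤ (N : ℝ) / 2 := by
  have hN' : (2 : ℝ) ≤ N := by exact_mod_cast hN
  rw [box, Set.mem_ofPred_eq, gNorm_le_iff (by positivity)]
  have : ∀ l, (if (k - j).2 l = 0 then (0 : ℝ) else 1) ≤ (N : ℝ) / 2 := fun l => by
    split_ifs <;> linarith
  simp only [this, implies_true, and_true]
  refine forall_congr' fun i => ?_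
  rw [← mul_sub]
  simp

theorem self_mem_box (s : Fin d → ℝ) {N : ℕ} (hN : 2 ≤ N) (j : RefGroup d e n) :
    j ∈ box s N j := by
  rw [mem_box_iff hN]
  intro i
  rw [sub_self, abs_zero]
  positivity

/-- Triangle inequality; the size conditions keep all three boxes of size at least `2`, where
torsion plays no role. -/
theorem mem_box_of_mem_box_sub {s : Fin d → ℝ} {N K : ℕ} (hK : 2 ≤ K) (hKN : K + 2 ≤ N)
    {j k c : RefGroup d e n} (hj : j ∈ box s (N - K) c) (hk : k ∈ box s K j) :
    k ∈ box s N c := by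
  rw [mem_box_iff (by omega)] at hj hk ⊢
  intro i
  have h1 := hj i
  have h2 := hk i
  have h3 := abs_sub_le (s i * (k.1 i : ℝ)) (s i * (j.1 i : ℝ)) (s i * (c.1 i : ℝ))
  rw [Nat.cast_sub (by omega)] at h1
  linarith

variable [∀ k, NeZero (n k)]

/-- The box `S_N(j)` as a finite set, for `N ≥ 2`. -/
noncomputable def boxFinset (s : Fin d → ℝ) (N : ℕ) (j : RefGroup d e n) : Finset (RefGroup d e n) :=
  latticeBox s (fun i => s i * (j.1 i : ℝ)) ((N : ℝ) / 2) ×ˢ Finset.univ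

theorem coe_boxFinset {s : Fin d → ℝ} (hs : ∀ i, 0 < s i) {N : ℕ} (hN : 2 ≤ N)
    (j : RefGroup d e n) : (boxFinset s N j : Set (RefGroup d e n)) = box s N j := by
  ext k
  rw [mem_box_iff hN, Finset.mem_coe, boxFinset, Finset.mem_product, mem_latticeBox hs]
  simp

theorem mem_boxFinset {s : Fin d → ℝ} (hs : ∀ i, 0 < s i) {N : ℕ} (hN : 2 ≤ N)
    {j k : RefGroup d e n} : k ∈ boxFinset s N j ↔ k ∈ box s N j := by
  rw [← coe_boxFinset hs hN, Finset.mem_coe]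

theorem card_boxFinset_pos {s : Fin d → ℝ} (hs : ∀ i, 0 < s i) {N : ℕ} (hN : 2 ≤ N)
    (j : RefGroup d e n) : 0 < (boxFinset s N j).card :=
  Finset.card_pos.mpr ⟨j, (mem_boxFinset hs hN).mpr (self_mem_box s hN j)⟩

theorem encard_box {s : Fin d → ℝ} (hs : ∀ i, 0 < s i) {N : ℕ} (hN : 2 ≤ N)
    (j : RefGroup d e n) : ((box s N j).encard : ℝ≥0∞) = ((boxFinset s N j).card : ℝ≥0∞) := by
  rw [← coe_boxFinset hs hN, Set.encard_coe_eq_coe_finsetCard, ENat.toENNReal_coe]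

theorem eventually_forall_le_div {t : Fin d → ℝ} (ht : ∀ i, 0 < t i) (M : ℝ) :
    ∀ᶠ N : ℕ in atTop, ∀ i, 1 ≤ ((N : ℝ) - M) / t i := by
  rw [eventually_all]
  intro i
  filter_upwards [eventually_ge_atTop ⌈t i + M⌉₊] with N hN
  rw [le_div_iff₀ (ht i)]
  have := Nat.ceil_le.mp hN
  linarith

/-- The order of the torsion part of `G`. -/
noncomputable def torsionCard (n : Fin e → ℕ) [∀ k, NeZero (n k)] : ℝ :=
  (Fintype.card ((k : Fin e) → ZMod (n k)) : ℝ)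

theorem torsionCard_pos : 0 < torsionCard n := by
  unfold torsionCard
  exact_mod_cast Fintype.card_pos

theorem card_boxFinset_bounds {s : Fin d → ℝ} {N : ℕ}
    (hN : ∀ i, 1 ≤ (N : ℝ) / s i) (j : RefGroup d e n) :
    (∏ i, ((N : ℝ) / s i - 1)) * torsionCard n ≤ ((boxFinset s N j).card : ℝ) ∧
      ((boxFinset s N j).card : ℝ) ≤ (∏ i, ((N : ℝ) / s i + 1)) * torsionCard n := by
  have e : 2 * ((N : ℝ) / 2) = N := by ring
  have h := card_latticeBox_bounds (x := fun i => s i * (j.1 i : ℝ)) (ρ := (N : ℝ) / 2)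
    (by simpa only [e] using hN)
  rw [e] at h
  have hT := torsionCard_pos (n := n)
  rw [boxFinset, Finset.card_product, Nat.cast_mul, Finset.card_univ]
  exact ⟨mul_le_mul_of_nonneg_right h.1 hT.le, mul_le_mul_of_nonneg_right h.2 hT.le⟩

/-- Boxes have uniformly negligible boundary layers. -/
theorem eventually_card_boxFinset_sub_le {s : Fin d → ℝ} (hs : ∀ i, 0 < s i) (K : ℕ) {η : ℝ}
    (hη : 0 < η) : ∀ᶠ N : ℕ in atTop, ∀ c : RefGroup d e n,
      ((boxFinset s N c).card : ℝ) - ((boxFinset s (N - K) c).card : ℝ) ≤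
        η * ((boxFinset s N c).card : ℝ) := by
  rcases le_or_gt 1 η with h1 | h1
  · refine Eventually.of_forall fun N c => ?_
    have : (0 : ℝ) ≤ (boxFinset s (N - K) c).card := by positivity
    have : (0 : ℝ) ≤ (boxFinset s N c).card := by positivity
    nlinarith
  -- The lower count for size `N - K` over the upper count for size `N`; the torsion factor cancels.
  have hlim := tendsto_prod_affine_div hs hs (fun i => -(K : ℝ) / s i - 1) (fun _ => 1)
  have hprod : ∏ i, s i / s i = 1 := Finset.prod_eq_one fun i _ => div_self (hs i).ne'
  rw [hprod] at hlim
  filter_upwards [hlim.eventually_const_lt (show 1 - η < 1 by linarith),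
    eventually_ge_atTop K, eventually_forall_le_div hs 0, eventually_forall_le_div hs K]
    with N h2 hK h3 h4 c
  simp only [sub_zero] at h3
  have hc : (((N - K : ℕ) : ℕ) : ℝ) = N - K := Nat.cast_sub hK
  have hup := (card_boxFinset_bounds h3 c).2
  have hlow := (card_boxFinset_bounds (N := N - K) (by rwa [hc]) c).1
  have hpos : 0 < ∏ i, ((N : ℝ) / s i + 1) :=
    Finset.prod_pos fun i _ => by linarith [h3 i]
  rw [lt_div_iff₀ hpos] at h2
  have e : ∏ i, ((N : ℝ) / s i + (-(K : ℝ) / s i - 1)) = ∏ i, (((N - K : ℕ) : ℝ) / s i - 1) :=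
    Finset.prod_congr rfl fun i _ => by rw [hc]; ring
  rw [e] at h2
  have hT := torsionCard_pos (n := n)
  have h5 := mul_le_mul_of_nonneg_right h2.le hT.le
  have h6 := mul_le_mul_of_nonneg_left hup (show 0 ≤ 1 - η by linarith)
  nlinarith

end Counting

end FrameDensity

/-! ### Comparison of the two diagonals over a box -/

namespace FrameDensity

section Comparison

/-- Weighted arithmetic-geometric mean: `x y ≤ x² / (2δ) + δ y² / 2`, and the two tails contribute
at most `δ / 2` and `δ C / 2`. It serves with small `δ` inside a box and with a large constant near
the boundary. -/
theorem abs_sub_sum_le_of_tail_le {ι : Type*} {m x y : ι → ℝ} {t C δ : ℝ} (hm : HasSum m t)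
    (hxy : ∀ i, |m i| ≤ x i * y i) (hx : Summable fun i => x i ^ 2)
    (hy : Summable fun i => y i ^ 2) (hC : ∑' i, y i ^ 2 ≤ C) (hδ : 0 < δ) (T : Finset ι)
    (hT : ∑' i : ((T : Set ι)ᶜ : Set ι), x i ^ 2 ≤ δ ^ 2) :
    |t - ∑ i ∈ T, m i| ≤ δ * ((1 + C) / 2) := by
  have h1 : t - ∑ i ∈ T, m i = ∑' i : ((T : Set ι)ᶜ : Set ι), m i := by
    rw [← hm.tsum_eq, ← hm.summable.sum_add_tsum_compl (s := T)]
    ring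
  have hm' : ∀ i, |m i| ≤ (δ⁻¹ / 2) * x i ^ 2 + (δ / 2) * y i ^ 2 := fun i => by
    refine (hxy i).trans ?_
    have : (δ⁻¹ / 2) * x i ^ 2 + (δ / 2) * y i ^ 2 - x i * y i =
        (δ⁻¹ / 2) * (x i - δ * y i) ^ 2 := by field_simp; ring
    have h2 : 0 ≤ (δ⁻¹ / 2) * (x i - δ * y i) ^ 2 := by positivity
    linarith
  have hxc : Summable fun i : ((T : Set ι)ᶜ : Set ι) => x i ^ 2 := hx.subtype _
  have hyc : Summable fun i : ((T : Set ι)ᶜ : Set ι) => y i ^ 2 := hy.subtype _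
  have hyC : ∑' i : ((T : Set ι)ᶜ : Set ι), y i ^ 2 ≤ C := by
    refine le_trans ?_ hC
    exact hy.tsum_subtype_le _ _ fun _ => by positivity
  have hs := (hxc.mul_left (δ⁻¹ / 2)).add (hyc.mul_left (δ / 2))
  have h3 : ‖∑' i : ((T : Set ι)ᶜ : Set ι), m i‖ ≤ _ := tsum_of_norm_bounded hs.hasSum
    (fun i : ((T : Set ι)ᶜ : Set ι) => (Real.norm_eq_abs (m i)).le.trans (hm' i))
  rw [h1, ← Real.norm_eq_abs]
  refine h3.trans ?_
  rw [(hxc.mul_left (δ⁻¹ / 2)).tsum_add (hyc.mul_left (δ / 2)), tsum_mul_left, tsum_mul_left]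
  have h4 : (δ⁻¹ / 2) * ∑' i : ((T : Set ι)ᶜ : Set ι), x i ^ 2 ≤ (δ⁻¹ / 2) * δ ^ 2 := by gcongr
  have h5 : (δ / 2) * ∑' i : ((T : Set ι)ᶜ : Set ι), y i ^ 2 ≤ (δ / 2) * C := by gcongr
  have h6 : (δ⁻¹ / 2) * δ ^ 2 = δ / 2 := by field_simp
  linarith

theorem tsum_compl_le_of_enorm_lt {𝕜 : Type*} [RCLike 𝕜] {ι : Type*} {z : ι → 𝕜}
    (hz : Summable fun i => ‖z i‖ ^ 2) {s t : Set ι} (hst : s ⊆ t) {ε : ℝ} (hε : 0 ≤ ε)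
    (h : ∑' i : (sᶜ : Set ι), ‖z i‖ₑ ^ 2 < ENNReal.ofReal ε) :
    ∑' i : (tᶜ : Set ι), ‖z i‖ ^ 2 ≤ ε := by
  have hz' : Summable fun i : (tᶜ : Set ι) => ‖z i‖ ^ 2 := hz.subtype _
  rw [← ENNReal.ofReal_le_ofReal_iff hε,
    ENNReal.ofReal_tsum_of_nonneg (fun _ => by positivity) hz']
  refine le_trans ?_ h.le
  simp only [ENNReal.ofReal_pow (norm_nonneg _), ofReal_norm]
  exact ENNReal.tsum_mono_subtype (fun i => ‖z i‖ₑ ^ 2) (Set.compl_subset_compl.mpr hst)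

/-- Separates interior indices (small error `u`) from boundary ones (crude error `v`). -/
theorem sum_le_of_le_of_filter_not {ι : Type*} (P : Finset ι) (p : ι → Prop) [DecidablePred p]
    {g : ι → ℝ} {u v : ℝ} (hu : 0 ≤ u) (h1 : ∀ i ∈ P, p i → g i ≤ u) (h2 : ∀ i ∈ P, g i ≤ v) :
    ∑ i ∈ P, g i ≤ u * (P.card : ℝ) + v * ((P.filter fun i => ¬ p i).card : ℝ) := by
  rw [← Finset.sum_filter_add_sum_filter_not P p]
  have e1 : ∑ i ∈ P with p i, g i ≤ ∑ i ∈ P with p i, u :=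
    Finset.sum_le_sum fun i hi => h1 i (Finset.mem_filter.mp hi).1 (Finset.mem_filter.mp hi).2
  have e2 : ∑ i ∈ P with ¬ p i, g i ≤ ∑ i ∈ P with ¬ p i, v :=
    Finset.sum_le_sum fun i hi => h2 i (Finset.mem_filter.mp hi).1
  have e3 : ((P.filter p).card : ℝ) ≤ P.card := by exact_mod_cast Finset.card_filter_le _ _
  rw [Finset.sum_const, nsmul_eq_mul] at e1 e2
  nlinarith

variable {d e : ℕ} {n : Fin e → ℕ} [∀ k, NeZero (n k)] {I : Type*}

/-- Finite upper density bounds the cardinalities of the fibres of `a`. -/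
theorem exists_fiber_bound {s : Fin d → ℝ} (hs : ∀ i, 0 < s i) {a : I → RefGroup d e n}
    (h : upperDensity s a < ⊤) : ∃ K : ℕ, ∀ g, (a ⁻¹' {g}).encard ≤ K := by
  obtain ⟨b, hb, -⟩ := ENNReal.lt_iff_exists_nnreal_btwn.mp h
  -- One fixed size suffices: the fibre over `g` lies in `I_N(g)`, and `|S_N(g)|` is bounded
  -- independently of `g`.
  obtain ⟨N, hN, h2, h3⟩ := ((eventually_lt_of_limsup_lt hb).and
    ((eventually_ge_atTop 2).and (eventually_forall_le_div hs 0))).exists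
  simp only [sub_zero] at h3
  obtain ⟨L, hL⟩ := exists_nat_ge ((∏ i, ((N : ℝ) / s i + 1)) * torsionCard n)
  obtain ⟨K, hK⟩ := exists_nat_ge (b * L : NNReal)
  refine ⟨K, fun g => ?_⟩
  have e1 : ((preBox s a N g).encard : ℝ≥0∞) / ((box s N g).encard : ℝ≥0∞) ≤ b :=
    (le_iSup (fun j => ((preBox s a N j).encard : ℝ≥0∞) / ((box s N j).encard : ℝ≥0∞)) g).trans
      hN.le
  rw [encard_box hs h2, ENNReal.div_le_iff (by exact_mod_cast (card_boxFinset_pos hs h2 g).ne')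
    (ENNReal.natCast_ne_top _)] at e1
  have e2 : (boxFinset s N g).card ≤ L := by
    exact_mod_cast ((card_boxFinset_bounds h3 g).2.trans hL)
  have e3 : a ⁻¹' {g} ⊆ preBox s a N g := by
    rintro i rfl
    exact self_mem_box s h2 _
  rw [← ENat.toENNReal_le]
  calc ((a ⁻¹' {g}).encard : ℝ≥0∞) ≤ (preBox s a N g).encard :=
        ENat.toENNReal_le.mpr (Set.encard_le_encard e3)
    _ ≤ b * (boxFinset s N g).card := e1
    _ ≤ b * L := by gcongr
    _ ≤ K := by exact_mod_cast hK
    _ = ((K : ℕ∞) : ℝ≥0∞) := by simp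

/-- The preimage of a finite set under a map with finite fibres. -/
noncomputable def preFinset {X : Type*} (a : I → X) (ha : ∀ g, (a ⁻¹' {g}).Finite) (Q : Finset X) :
    Finset I :=
  (Q.finite_toSet.preimage' fun g _ => ha g).toFinset

theorem mem_preFinset {X : Type*} {a : I → X} {ha : ∀ g, (a ⁻¹' {g}).Finite} {Q : Finset X} {i : I} :
    i ∈ preFinset a ha Q ↔ a i ∈ Q := by
  simp [preFinset]

theorem card_preFinset_le {X : Type*} {a : I → X} {ha : ∀ g, (a ⁻¹' {g}).Finite} {K : ℕ}
    (hK : ∀ g, (a ⁻¹' {g}).encard ≤ K) (Q : Finset X) :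
    (preFinset a ha Q).card ≤ K * Q.card := by
  classical
  refine Finset.card_le_mul_card_image_of_maps_to (f := a) (fun i hi => mem_preFinset.mp hi) K
    fun g _ => ?_
  have h : (((preFinset a ha Q).filter fun i => a i = g : Finset I) : Set I) ⊆ a ⁻¹' {g} :=
    fun i hi => (Finset.mem_filter.mp (Finset.mem_coe.mp hi)).2
  have := (Set.encard_le_encard h).trans (hK g)
  rw [Set.encard_coe_eq_coe_finsetCard] at this
  exact_mod_cast this

theorem finite_fibers_of_bound {X : Type*} {a : I → X} {K : ℕ}
    (hK : ∀ g, (a ⁻¹' {g}).encard ≤ K) (g : X) : (a ⁻¹' {g}).Finite :=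
  Set.finite_of_encard_le_coe (hK g)

theorem coe_preFinset_boxFinset {s : Fin d → ℝ} (hs : ∀ i, 0 < s i) {a : I → RefGroup d e n}
    {ha : ∀ g, (a ⁻¹' {g}).Finite} {N : ℕ} (hN : 2 ≤ N) (c : RefGroup d e n) :
    (preFinset a ha (boxFinset s N c) : Set I) = preBox s a N c := by
  ext i
  rw [Finset.mem_coe, mem_preFinset, mem_boxFinset hs hN]
  rfl

variable {𝕜 : Type*} [RCLike 𝕜] {H : Type*} [NormedAddCommGroup H] [InnerProductSpace 𝕜 H]
  [CompleteSpace H]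

/-- Under `ℓ²` row and column decay the sums of `⟨fᵢ, f̃ᵢ⟩` over `I_N(c)` exceed those of
`⟨eⱼ, ẽⱼ⟩` over `S_N(c)` by at most `o(|S_N|)`, uniformly in `c`. -/
theorem eventually_sum_dualDiag_le {s : Fin d → ℝ} (hs : ∀ i, 0 < s i) {a : I → RefGroup d e n}
    {f : I → H} {E : RefGroup d e n → H} {A B A' B' : ℝ}
    (hf : IsFrameForWith 𝕜 ⊤ f A B) (hE : IsFrameForWith 𝕜 ⊤ E A' B')
    (hcol : HasL2ColumnDecay 𝕜 s a f E) (hrow : HasL2RowDecay 𝕜 s a f E)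
    {K : ℕ} (hK : ∀ g, (a ⁻¹' {g}).encard ≤ K) {η : ℝ} (hη : 0 < η) :
    ∀ᶠ N : ℕ in atTop, ∀ c : RefGroup d e n,
      ∑ i ∈ preFinset a (finite_fibers_of_bound hK) (boxFinset s N c), dualDiag 𝕜 f i ≤
        ∑ j ∈ boxFinset s N c, dualDiag 𝕜 E j + η * ((boxFinset s N c).card : ℝ) := by
  classical
  set ha := finite_fibers_of_bound hK
  obtain ⟨hfr, -, D, hD, hfD, hdD, hdb⟩ := hf.canonicalDual_spec
  obtain ⟨hEr, -, D', hD', hED, heD, heb⟩ := hE.canonicalDual_spec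
  set m : I → RefGroup d e n → ℝ := fun i j =>
    RCLike.re (inner 𝕜 (canonicalDual 𝕜 E j) (canonicalDual 𝕜 f i) * inner 𝕜 (f i) (E j)) with hm
  have hmrow : ∀ i, HasSum (m i) (dualDiag 𝕜 f i) := fun i => by
    have h := (hEr (f i) (canonicalDual 𝕜 f i)).mapL RCLike.reCLM
    rw [dualDiag, ← RCLike.conj_re, inner_conj_symm]
    exact h
  have hmcol : ∀ j, HasSum (fun i => m i j) (dualDiag 𝕜 E j) := fun j => by
    have h := (hfr (E j) (canonicalDual 𝕜 E j)).mapL RCLike.reCLM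
    rw [dualDiag, ← RCLike.conj_re, inner_conj_symm]
    refine h.congr_fun fun i => ?_
    simp only [hm, RCLike.reCLM_apply]
    rw [← RCLike.conj_re, map_mul, inner_conj_symm, inner_conj_symm]
  have hmle : ∀ i j, |m i j| ≤ ‖inner 𝕜 (E j) (f i)‖ *
      ‖inner 𝕜 (canonicalDual 𝕜 E j) (canonicalDual 𝕜 f i)‖ := fun i j => by
    refine (RCLike.abs_re_le_norm _).trans ?_
    rw [norm_mul, mul_comm, norm_inner_symm (f i)]
  set C := D * D' with hC
  have hxrow : ∀ i, Summable fun j => ‖inner 𝕜 (E j) (f i)‖ ^ 2 := fun i => hE.summable (f i)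
  have hxcol : ∀ j, Summable fun i => ‖inner 𝕜 (E j) (f i)‖ ^ 2 := fun j => by
    simpa only [norm_inner_symm] using hf.summable (E j)
  have hyrow : ∀ i, ∑' j, ‖inner 𝕜 (canonicalDual 𝕜 E j) (canonicalDual 𝕜 f i)‖ ^ 2 ≤ C :=
    fun i => (heb _).2.trans (by rw [hC, mul_comm D]; gcongr; exact hdD i)
  have hycol : ∀ j, Summable (fun i =>
        ‖inner 𝕜 (canonicalDual 𝕜 E j) (canonicalDual 𝕜 f i)‖ ^ 2) ∧
      ∑' i, ‖inner 𝕜 (canonicalDual 𝕜 E j) (canonicalDual 𝕜 f i)‖ ^ 2 ≤ C := fun j => by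
    simp only [norm_inner_symm (canonicalDual 𝕜 E j)]
    exact ⟨(hdb _).1, (hdb _).2.trans (by rw [hC]; gcongr; exact heD j)⟩
  -- A Bessel bound for all rows and columns of `⟨fᵢ, eⱼ⟩`. The summand `1` gives `X ≤ X²`, so the
  -- tail estimate applies with `δ = X` to boundary indices.
  set X := 1 + (B' * D + B * D') with hX
  have hB : 0 < B := hf.2.1
  have hB' : 0 < B' := hE.2.1
  have hX0 : 0 < X := by positivity
  have hXX : X ≤ X ^ 2 := by
    have : 1 ≤ X := by rw [hX]; linarith [mul_pos hB' hD, mul_pos hB hD']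
    nlinarith
  have hxrowX : ∀ (i : I) (T : Finset (RefGroup d e n)),
      ∑' j : ((T : Set (RefGroup d e n))ᶜ : Set (RefGroup d e n)),
        ‖inner 𝕜 (E j) (f i)‖ ^ 2 ≤ X ^ 2 := fun i T => by
    refine (((hxrow i).tsum_subtype_le _ _ fun _ => by positivity).trans
      (hE.2.2.2 (f i) trivial).2.2).trans (le_trans ?_ hXX)
    have := mul_le_mul_of_nonneg_left (hfD i) hB'.le
    rw [hX]
    linarith [mul_pos hB hD']
  have hxcolX : ∀ (j : RefGroup d e n) (T : Finset I),
      ∑' i : ((T : Set I)ᶜ : Set I), ‖inner 𝕜 (E j) (f i)‖ ^ 2 ≤ X ^ 2 := fun j T => by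
    have h0 := (hf.2.2.2 (E j) trivial).2.2
    simp only [norm_inner_symm _ (E j)] at h0
    refine (((hxcol j).tsum_subtype_le _ _ fun _ => by positivity).trans h0).trans (le_trans ?_ hXX)
    have := mul_le_mul_of_nonneg_left (hED j) hB.le
    rw [hX]
    linarith [mul_pos hB' hD]
  set w := (1 + C) / 2 with hw
  have hw0 : 0 < w := by positivity
  -- At most `K |Q|` rows and `|Q|` columns each err by `δ w`, in total `η |Q| / 2`; the boundary
  -- fraction below is chosen to spend the other half.
  set δ := η / (2 * w * (K + 1)) with hδ
  have hδ0 : 0 < δ := by positivity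
  obtain ⟨N₁, -, hN₁⟩ := hcol (δ ^ 2) (by positivity)
  obtain ⟨N₂, -, hN₂⟩ := hrow (δ ^ 2) (by positivity)
  set R := N₁ + N₂ + 2 with hR
  filter_upwards [eventually_card_boxFinset_sub_le (n := n) hs R
    (show 0 < η / (2 * X * w * (K + 1)) by positivity), eventually_ge_atTop (R + 2)] with N hN hRN c
  set Q := boxFinset s N c with hQ
  set Q' := boxFinset s (N - R) c with hQ'
  set P := preFinset a ha Q with hP
  have hQQ : Q' ⊆ Q := fun k hk => by
    rw [mem_boxFinset hs (by omega)] at hk ⊢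
    exact box_mono s (by omega) c hk
  have hin : ∀ j ∈ Q', ∀ k ∈ box s R j, k ∈ Q := fun j hj k hk => by
    rw [mem_boxFinset hs (by omega)] at hj ⊢
    exact mem_box_of_mem_box_sub (by omega) hRN hj hk
  have hrowsum : ∑ i ∈ P, |dualDiag 𝕜 f i - ∑ j ∈ Q, m i j| ≤
      δ * w * (P.card : ℝ) + X * w * ((P.filter fun i => ¬ a i ∈ Q').card : ℝ) := by
    refine sum_le_of_le_of_filter_not P (fun i => a i ∈ Q') (by positivity)
      (fun i _ hi => ?_) fun i _ => ?_
    · refine abs_sub_sum_le_of_tail_le (hmrow i) (hmle i) (hxrow i) (heb _).1 (hyrow i) hδ0 Q ?_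
      exact tsum_compl_le_of_enorm_lt (hxrow i)
        (fun k hk => hin _ hi k (box_mono s (by omega) _ hk)) (by positivity) (hN₂ i)
    · exact abs_sub_sum_le_of_tail_le (hmrow i) (hmle i) (hxrow i) (heb _).1 (hyrow i) hX0 Q
        (hxrowX i Q)
  have hcolsum : ∑ j ∈ Q, |dualDiag 𝕜 E j - ∑ i ∈ P, m i j| ≤
      δ * w * (Q.card : ℝ) + X * w * ((Q.filter fun j => ¬ j ∈ Q').card : ℝ) := by
    refine sum_le_of_le_of_filter_not Q (fun j => j ∈ Q') (by positivity)
      (fun j _ hj => ?_) fun j _ => ?_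
    · refine abs_sub_sum_le_of_tail_le (hmcol j) (fun i => hmle i j) (hxcol j) (hycol j).1
        (hycol j).2 hδ0 P ?_
      exact tsum_compl_le_of_enorm_lt (hxcol j)
        (fun i hi => mem_preFinset.mpr (hin _ hj _ (box_mono s (by omega) _ hi)))
        (by positivity) (hN₁ j)
    · exact abs_sub_sum_le_of_tail_le (hmcol j) (fun i => hmle i j) (hxcol j) (hycol j).1
        (hycol j).2 hX0 P (hxcolX j P)
  have hPc : (P.card : ℝ) ≤ K * (Q.card : ℝ) := by exact_mod_cast card_preFinset_le hK Q
  have hsd : ((Q \ Q').card : ℝ) = (Q.card : ℝ) - (Q'.card : ℝ) := by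
    rw [Finset.card_sdiff_of_subset hQQ, Nat.cast_sub (Finset.card_le_card hQQ)]
  have hQf : ((Q.filter fun j => ¬ j ∈ Q').card : ℝ) = (Q.card : ℝ) - (Q'.card : ℝ) := by
    rw [← hsd, Finset.sdiff_eq_filter]
  have hPf : ((P.filter fun i => ¬ a i ∈ Q').card : ℝ) ≤
      K * ((Q.card : ℝ) - (Q'.card : ℝ)) := by
    have h1 : (P.filter fun i => ¬ a i ∈ Q') ⊆ preFinset a ha (Q \ Q') := fun i hi => by
      rw [Finset.mem_filter] at hi
      rw [mem_preFinset, Finset.mem_sdiff]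
      exact ⟨mem_preFinset.mp hi.1, hi.2⟩
    rw [← hsd]
    exact_mod_cast (Finset.card_le_card h1).trans (card_preFinset_le hK _)
  -- The sum of `m` over the block `P × Q` approximates both sides and cancels.
  have hdiff : ∑ i ∈ P, dualDiag 𝕜 f i - ∑ j ∈ Q, dualDiag 𝕜 E j ≤
      ∑ i ∈ P, |dualDiag 𝕜 f i - ∑ j ∈ Q, m i j| +
        ∑ j ∈ Q, |dualDiag 𝕜 E j - ∑ i ∈ P, m i j| := by
    have h1 : ∑ i ∈ P, (dualDiag 𝕜 f i - ∑ j ∈ Q, m i j) ≤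
        ∑ i ∈ P, |dualDiag 𝕜 f i - ∑ j ∈ Q, m i j| := Finset.sum_le_sum fun _ _ => le_abs_self _
    have h2 : ∑ j ∈ Q, -(dualDiag 𝕜 E j - ∑ i ∈ P, m i j) ≤
        ∑ j ∈ Q, |dualDiag 𝕜 E j - ∑ i ∈ P, m i j| := Finset.sum_le_sum fun _ _ => neg_le_abs _
    rw [Finset.sum_neg_distrib] at h2
    rw [Finset.sum_sub_distrib] at h1 h2
    rw [Finset.sum_comm] at h1
    linarith
  have hNc := hN c
  have g1 : δ * w * (P.card : ℝ) ≤ δ * w * (K * (Q.card : ℝ)) := by gcongr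
  have g2 : X * w * ((P.filter fun i => ¬ a i ∈ Q').card : ℝ) ≤
      X * w * (K * (η / (2 * X * w * (K + 1)) * (Q.card : ℝ))) := by
    gcongr
    exact hPf.trans (by gcongr)
  have g3 : X * w * ((Q.filter fun j => ¬ j ∈ Q').card : ℝ) ≤
      X * w * (η / (2 * X * w * (K + 1)) * (Q.card : ℝ)) := by
    rw [hQf]
    gcongr
  have g4 : δ * w * (K * (Q.card : ℝ)) +
      X * w * (K * (η / (2 * X * w * (K + 1)) * (Q.card : ℝ))) + δ * w * (Q.card : ℝ) +
      X * w * (η / (2 * X * w * (K + 1)) * (Q.card : ℝ)) = η * Q.card := by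
    rw [hδ]
    field_simp
    ring
  linarith

end Comparison

end FrameDensity

/-! ### Densities, upper measures and sparse removable sets -/

namespace FrameDensity

section Density

open Topology

theorem preFinset_id {X : Type*} (ha : ∀ g : X, (id ⁻¹' {g} : Set X).Finite) (Q : Finset X) :
    preFinset id ha Q = Q := by
  ext i
  exact mem_preFinset

variable {d e : ℕ} {n : Fin e → ℕ} [∀ k, NeZero (n k)] {I : Type*}

theorem encard_preBox {s : Fin d → ℝ} (hs : ∀ i, 0 < s i) {a : I → RefGroup d e n}
    (ha : ∀ g, (a ⁻¹' {g}).Finite) {N : ℕ} (hN : 2 ≤ N) (c : RefGroup d e n) :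
    ((preBox s a N c).encard : ℝ≥0∞) = ((preFinset a ha (boxFinset s N c)).card : ℝ≥0∞) := by
  rw [← coe_preFinset_boxFinset hs (ha := ha) hN, Set.encard_coe_eq_coe_finsetCard,
    ENat.toENNReal_coe]

theorem tsum_preBox_ofReal {s : Fin d → ℝ} (hs : ∀ i, 0 < s i) {a : I → RefGroup d e n}
    (ha : ∀ g, (a ⁻¹' {g}).Finite) {N : ℕ} (hN : 2 ≤ N) (c : RefGroup d e n) {g : I → ℝ}
    (hg : ∀ i, 0 ≤ g i) :
    ∑' i : preBox s a N c, ENNReal.ofReal (g i) =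
      ENNReal.ofReal (∑ i ∈ preFinset a ha (boxFinset s N c), g i) := by
  rw [← coe_preFinset_boxFinset hs (ha := ha) hN, Finset.tsum_subtype' _
    (fun i => ENNReal.ofReal (g i)), ENNReal.ofReal_sum_of_nonneg fun i _ => hg i]

theorem eventually_mul_card_le_of_lt_lowerDensity {s : Fin d → ℝ} (hs : ∀ i, 0 < s i)
    {a : I → RefGroup d e n} (ha : ∀ g, (a ⁻¹' {g}).Finite) {q : NNReal}
    (hq : (q : ℝ≥0∞) < lowerDensity s a) :
    ∀ᶠ N : ℕ in atTop, ∀ c : RefGroup d e n,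
      (q : ℝ) * ((boxFinset s N c).card : ℝ) ≤ ((preFinset a ha (boxFinset s N c)).card : ℝ) := by
  filter_upwards [eventually_lt_of_lt_liminf hq, eventually_ge_atTop 2] with N h1 h2 c
  have h3 := h1.le.trans (iInf_le _ c)
  rw [encard_box hs h2, encard_preBox hs ha h2, ENNReal.le_div_iff_mul_le
    (Or.inl (by exact_mod_cast (card_boxFinset_pos hs h2 c).ne'))
    (Or.inl (ENNReal.natCast_ne_top _))] at h3
  have h4 : q * ((boxFinset s N c).card : NNReal) ≤
      ((preFinset a ha (boxFinset s N c)).card : NNReal) := by exact_mod_cast h3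
  exact_mod_cast h4

variable {𝕜 : Type*} [RCLike 𝕜] {H : Type*} [NormedAddCommGroup H] [InnerProductSpace 𝕜 H]

/-- A family with `⟨eⱼ, ẽⱼ⟩ = 1` for all `j` has upper measure `1`. -/
theorem upperMeasure_eq_one {s : Fin d → ℝ} (hs : ∀ i, 0 < s i) {E : RefGroup d e n → H}
    (h : ∀ j, dualDiag 𝕜 E j = 1) : upperMeasure 𝕜 s id E = 1 := by
  have ha : ∀ g : RefGroup d e n, (id ⁻¹' {g} : Set (RefGroup d e n)).Finite :=
    fun g => Set.finite_singleton g
  rw [upperMeasure]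
  refine (tendsto_const_nhds.congr' ?_).limsup_eq
  filter_upwards [eventually_ge_atTop 2] with N hN
  have hterm : ∀ j : RefGroup d e n, (∑' i : preBox s id N j, ENNReal.ofReal (dualDiag 𝕜 E i)) /
      ((preBox s id N j).encard : ℝ≥0∞) = 1 := fun j => by
    have hj : ((boxFinset s N j).card : ℝ≥0∞) ≠ 0 := by
      exact_mod_cast (card_boxFinset_pos hs hN j).ne'
    rw [tsum_preBox_ofReal hs ha hN j (fun i => by rw [h i]; exact zero_le_one),
      encard_preBox hs ha hN, preFinset_id]
    simp only [h, Finset.sum_const, nsmul_eq_mul, mul_one, ENNReal.ofReal_natCast]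
    exact ENNReal.div_self hj (ENNReal.natCast_ne_top _)
  simp only [hterm, ciSup_const]

variable [CompleteSpace H]

/-- If the reference frame has upper measure below the lower density of `a`, then `M⁺(F) < 1`. -/
theorem upperMeasure_lt_one {s : Fin d → ℝ} (hs : ∀ i, 0 < s i) {a : I → RefGroup d e n}
    {f : I → H} {E : RefGroup d e n → H} {A B A' B' : ℝ}
    (hf : IsFrameForWith 𝕜 ⊤ f A B) (hE : IsFrameForWith 𝕜 ⊤ E A' B')
    (hup : upperDensity s a < ⊤)
    (hcol : HasL2ColumnDecay 𝕜 s a f E) (hrow : HasL2RowDecay 𝕜 s a f E)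
    (h : upperMeasure 𝕜 s id E < lowerDensity s a) : upperMeasure 𝕜 s a f < 1 := by
  obtain ⟨K, hK⟩ := exists_fiber_bound hs hup
  have ha := finite_fibers_of_bound hK
  have hid : ∀ g : RefGroup d e n, (id ⁻¹' {g} : Set (RefGroup d e n)).Finite :=
    fun g => Set.finite_singleton g
  obtain ⟨q, hEq, hq⟩ := ENNReal.lt_iff_exists_nnreal_btwn.mp h
  obtain ⟨p, hEp, hpq⟩ := ENNReal.lt_iff_exists_nnreal_btwn.mp hEq
  have hpq' : (p : ℝ) < q := by exact_mod_cast hpq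
  have hp0 : (0 : ℝ) ≤ p := p.2
  have hq0 : (0 : ℝ) < q := hp0.trans_lt hpq'
  -- With `M⁺(E) < p < q < D⁻` and comparison error `(q - p) / 2`, the sum over `I_N(c)` is at most
  -- `v q |S_N(c)| ≤ v |I_N(c)|`.
  set v : ℝ := ((p : ℝ) + ((q : ℝ) - p) / 2) / q with hv
  have hv1 : v < 1 := by rw [hv, div_lt_one hq0]; linarith
  refine lt_of_le_of_lt (b := ENNReal.ofReal v) ?_ (by rwa [ENNReal.ofReal_lt_one])
  rw [upperMeasure]
  refine limsup_le_of_le (by isBoundedDefault) ?_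
  filter_upwards [eventually_lt_of_limsup_lt hEp, eventually_ge_atTop 2,
    eventually_mul_card_le_of_lt_lowerDensity hs ha hq,
    eventually_sum_dualDiag_le hs hf hE hcol hrow hK (half_pos (sub_pos.mpr hpq'))]
    with N h1 h2 h3 h4
  refine iSup_le fun c => ?_
  have h5 := iSup_le_iff.mp h1.le c
  have hQ : (0 : ℝ) < (boxFinset s N c).card := by exact_mod_cast card_boxFinset_pos hs h2 c
  rw [tsum_preBox_ofReal hs hid h2 c hE.canonicalDual_spec.2.1, encard_preBox hs hid h2,
    preFinset_id, ENNReal.div_le_iff (by exact_mod_cast hQ.ne') (ENNReal.natCast_ne_top _),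
    ← ENNReal.ofReal_natCast, ← ENNReal.ofReal_coe_nnreal, ← ENNReal.ofReal_mul p.coe_nonneg,
    ENNReal.ofReal_le_ofReal_iff (by positivity)] at h5
  have h6 := h3 c
  have h7 := h4 c
  rw [tsum_preBox_ofReal hs ha h2 c hf.canonicalDual_spec.2.1, encard_preBox hs ha h2]
  refine ENNReal.div_le_of_le_mul ?_
  rw [← ENNReal.ofReal_natCast, ← ENNReal.ofReal_mul (by positivity)]
  refine ENNReal.ofReal_le_ofReal ?_
  have h8 : v * ((q : ℝ) * (boxFinset s N c).card) =
      p * (boxFinset s N c).card + ((q : ℝ) - p) / 2 * (boxFinset s N c).card := by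
    rw [hv]; field_simp
  have h9 := mul_le_mul_of_nonneg_left h6 (show 0 ≤ v by positivity)
  linarith

/-- If `M⁺(F) < α`, the indices with `⟨fᵢ, f̃ᵢ⟩ ≤ α` are relatively dense. -/
theorem exists_forall_dualDiag_le {s : Fin d → ℝ} (hs : ∀ i, 0 < s i) {a : I → RefGroup d e n}
    {f : I → H} {A B : ℝ} (hf : IsFrameForWith 𝕜 ⊤ f A B)
    (hlow : 0 < lowerDensity s a) (hup : upperDensity s a < ⊤) {α : ℝ}
    (h : upperMeasure 𝕜 s a f < ENNReal.ofReal α) :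
    ∃ M : ℕ, 2 ≤ M ∧ ∀ c : RefGroup d e n, ∃ i, dualDiag 𝕜 f i ≤ α ∧ a i ∈ box s M c := by
  obtain ⟨K, hK⟩ := exists_fiber_bound hs hup
  have ha := finite_fibers_of_bound hK
  obtain ⟨q, hq0, hq⟩ := ENNReal.lt_iff_exists_nnreal_btwn.mp hlow
  obtain ⟨N, h1, h2, h3⟩ := ((eventually_lt_of_limsup_lt h).and ((eventually_ge_atTop 2).and
    (eventually_mul_card_le_of_lt_lowerDensity hs ha hq))).exists
  refine ⟨N, h2, fun c => ?_⟩
  -- Otherwise the average over `I_N(c)` would be at least `α`; positive lower density ensures that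
  -- `I_N(c)` is nonempty.
  by_contra! hcon
  have hα : 0 < α := ENNReal.ofReal_pos.mp (bot_le.trans_lt h)
  have h4 := (le_iSup (fun j => (∑' i : preBox s a N j, ENNReal.ofReal (dualDiag 𝕜 f i)) /
      ((preBox s a N j).encard : ℝ≥0∞)) c).trans_lt h1
  have hq0' : (0 : ℝ) < q := by exact_mod_cast hq0
  have hQ : (0 : ℝ) < (boxFinset s N c).card := by exact_mod_cast card_boxFinset_pos hs h2 c
  have hP : (0 : ℝ) < (preFinset a ha (boxFinset s N c)).card := (mul_pos hq0' hQ).trans_le (h3 c)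
  refine h4.not_ge ?_
  rw [tsum_preBox_ofReal hs ha h2 c hf.canonicalDual_spec.2.1, encard_preBox hs ha h2,
    ENNReal.le_div_iff_mul_le (Or.inl (by exact_mod_cast hP.ne'))
      (Or.inl (ENNReal.natCast_ne_top _)), ← ENNReal.ofReal_natCast, ← ENNReal.ofReal_mul hα.le]
  refine ENNReal.ofReal_le_ofReal ?_
  rw [mul_comm, ← nsmul_eq_mul]
  refine Finset.card_nsmul_le_sum _ _ _ fun i hi => ?_
  by_contra! hlt
  exact hcon i hlt.le ((mem_boxFinset hs h2).mp (mem_preFinset.mp hi))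

/-- A relatively dense set of indices contains a sparse subset of uniform positive density. -/
theorem exists_sparse_subset {s : Fin d → ℝ} (hs : ∀ i, 0 < s i) {a : I → RefGroup d e n}
    {J₀ : Set I} {M : ℕ} (hM : 2 ≤ M) (hJ₀ : ∀ c : RefGroup d e n, ∃ i ∈ J₀, a i ∈ box s M c)
    (T : Finset (RefGroup d e n)) :
    ∃ J ⊆ J₀, upperDensity s (fun i : J => a i) = lowerDensity s (fun i : J => a i) ∧
      0 < lowerDensity s (fun i : J => a i) ∧
      ∀ i ∈ J, ∀ j ∈ J, i ≠ j → a i - a j ∉ T := by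
  set R : ℝ := ∑ g ∈ T, ∑ i, |s i * (g.1 i : ℝ)| with hR
  have hR0 : 0 ≤ R := by positivity
  have hTR : ∀ g ∈ T, ∀ i, |s i * (g.1 i : ℝ)| ≤ R := fun g hg i =>
    (Finset.single_le_sum (f := fun i => |s i * (g.1 i : ℝ)|) (fun _ _ => abs_nonneg _)
      (Finset.mem_univ i)).trans
      (Finset.single_le_sum (f := fun g : RefGroup d e n => ∑ i, |s i * (g.1 i : ℝ)|)
        (fun _ _ => Finset.sum_nonneg fun _ _ => abs_nonneg _) hg)
  -- Spacing `s i * L > R + M`: moving two lattice points by at most `M / 2` each leaves some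
  -- coordinate differing by more than `R`, which no element of `T` allows.
  obtain ⟨L, hL0, hL⟩ : ∃ L : ℕ, 0 < L ∧ ∀ i, (R + M) / s i < L :=
    ((eventually_gt_atTop 0).and (eventually_all.mpr fun i =>
      tendsto_natCast_atTop_atTop.eventually_gt_atTop ((R + M) / s i))).exists
  have hM0 : (0 : ℝ) < M := by exact_mod_cast (by omega : 0 < M)
  have hL0' : (0 : ℝ) < L := by exact_mod_cast hL0
  choose k hkJ hk using fun q : Fin d → ℤ => hJ₀ (fun i => (L : ℤ) * q i, 0)
  have hk' : ∀ q i, |s i * ((a (k q)).1 i : ℝ) - s i * L * q i| ≤ (M : ℝ) / 2 := fun q i => by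
    have := (mem_box_iff hM).mp (hk q) i
    push_cast at this
    rwa [← mul_assoc] at this
  have hsep : ∀ q q', q ≠ q' → ∃ i, R < |s i * ((a (k q) - a (k q')).1 i : ℝ)| := by
    intro q q' hqq
    obtain ⟨i, hi⟩ := Function.ne_iff.mp hqq
    refine ⟨i, ?_⟩
    have h1 := hk' q i
    have h2 := hk' q' i
    have h3 : (1 : ℝ) ≤ |(q i : ℝ) - q' i| := by
      exact_mod_cast Int.one_le_abs (sub_ne_zero.mpr hi)
    have h4 : s i * L ≤ |s i * L * q i - s i * L * q' i| := by
      rw [← mul_sub, abs_mul, abs_of_pos (mul_pos (hs i) hL0')]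
      exact le_mul_of_one_le_right (mul_pos (hs i) hL0').le h3
    have h5 := (div_lt_iff₀ (hs i)).mp (hL i)
    have h6 : s i * ((a (k q) - a (k q')).1 i : ℝ) =
        s i * ((a (k q)).1 i : ℝ) - s i * ((a (k q')).1 i : ℝ) := by
      simp [mul_sub]
    rw [h6]
    rw [abs_le] at h1 h2
    rcases le_abs'.mp h4 with h7 | h7
    · rw [lt_abs]; right; linarith
    · rw [lt_abs]; left; linarith
  have hkinj : Function.Injective k := by
    intro q q' hqq
    by_contra hne
    obtain ⟨i, hi⟩ := hsep q q' hne
    rw [hqq, sub_self] at hi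
    simp at hi
    linarith
  let φ : (Fin d → ℤ) → Set.range k := Set.rangeFactorization k
  have hφ : Function.Injective φ := fun q q' h => hkinj (congrArg Subtype.val h)
  set t : Fin d → ℝ := fun i => s i * L with ht
  have ht0 : ∀ i, 0 < t i := fun i => mul_pos (hs i) hL0'
  -- As `a (k q)` is within `M / 2` of the lattice point of `q`, the count lies between lattice
  -- counts with radii `(N ∓ M) / 2`.
  have hcount : ∀ N : ℕ, 2 ≤ N → ∀ c : RefGroup d e n,
      (((latticeBox t (fun i => s i * (c.1 i : ℝ)) (((N : ℝ) - M) / 2)).card : ℕ∞) ≤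
        (preBox s (fun i : Set.range k => a i) N c).encard) ∧
      ((preBox s (fun i : Set.range k => a i) N c).encard ≤
        ((latticeBox t (fun i => s i * (c.1 i : ℝ)) (((N : ℝ) + M) / 2)).card : ℕ∞)) := by
    intro N hN c
    have himg : preBox s (fun i : Set.range k => a i) N c = φ '' {q | a (k q) ∈ box s N c} := by
      ext ⟨_, q, rfl⟩
      constructor
      · intro h; exact ⟨q, h, rfl⟩
      · rintro ⟨q', h, h'⟩
        rw [← h']
        exact h
    rw [himg, hφ.encard_image]
    simp only [← Set.encard_coe_eq_coe_finsetCard]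
    constructor <;> refine Set.encard_le_encard fun q hq => ?_
    · rw [Finset.mem_coe, mem_latticeBox ht0] at hq
      rw [Set.mem_ofPred_eq, mem_box_iff hN]
      intro i
      have h1 := abs_le.mp (hq i)
      have h2 := abs_le.mp (hk' q i)
      rw [abs_le]
      constructor <;> linarith [h1.1, h1.2, h2.1, h2.2]
    · rw [Set.mem_ofPred_eq, mem_box_iff hN] at hq
      rw [Finset.mem_coe, mem_latticeBox ht0]
      intro i
      have h1 := abs_le.mp (hq i)
      have h2 := abs_le.mp (hk' q i)
      rw [abs_le]
      constructor <;> linarith [h1.1, h1.2, h2.1, h2.2]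
  have hT0 := torsionCard_pos (n := n)
  -- The expected density: one chosen index per `L ^ d` times the torsion order elements of `G`.
  set W : ℝ := (∏ i, s i / t i) / torsionCard n with hW
  have hW0 : 0 < W := div_pos (Finset.prod_pos fun i _ => div_pos (hs i) (ht0 i)) hT0
  have hlo := (tendsto_prod_affine_div ht0 hs (fun i => -(M : ℝ) / t i - 1) (fun _ => 1)).div_const
    (torsionCard n)
  have hhi := (tendsto_prod_affine_div ht0 hs (fun i => (M : ℝ) / t i + 1)
    (fun _ => -1)).div_const (torsionCard n)
  have hbd : ∀ᶠ N : ℕ in atTop, ∀ c : RefGroup d e n,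
      ENNReal.ofReal ((∏ i, ((N : ℝ) / t i + (-(M : ℝ) / t i - 1))) /
        (∏ i, ((N : ℝ) / s i + 1)) / torsionCard n) ≤
        ((preBox s (fun i : Set.range k => a i) N c).encard : ℝ≥0∞) /
          ((box s N c).encard : ℝ≥0∞) ∧
      ((preBox s (fun i : Set.range k => a i) N c).encard : ℝ≥0∞) /
          ((box s N c).encard : ℝ≥0∞) ≤
        ENNReal.ofReal ((∏ i, ((N : ℝ) / t i + ((M : ℝ) / t i + 1))) /
          (∏ i, ((N : ℝ) / s i + -1)) / torsionCard n) := by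
    filter_upwards [eventually_ge_atTop 2, eventually_forall_le_div hs M,
      eventually_forall_le_div ht0 M] with N h2 h3 h4 c
    have hs1 : ∀ i, 1 < (N : ℝ) / s i := fun i => by
      refine (h3 i).trans_lt ?_
      have := hs i
      gcongr
      linarith
    have hcb := card_boxFinset_bounds (fun i => (hs1 i).le) c
    obtain ⟨hc1, hc2⟩ := hcount N h2 c
    have hc1' := ENat.toENNReal_le.mpr hc1
    have hc2' := ENat.toENNReal_le.mpr hc2
    rw [ENat.toENNReal_coe, ← ENNReal.ofReal_natCast] at hc1' hc2'
    have e1 : 2 * (((N : ℝ) - M) / 2) = N - M := by ring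
    have e2 : 2 * (((N : ℝ) + M) / 2) = N + M := by ring
    have hl1 := (card_latticeBox_bounds (t := t) (x := fun i => s i * (c.1 i : ℝ))
      (ρ := ((N : ℝ) - M) / 2) (by simpa only [e1] using h4)).1
    have hl2 := (card_latticeBox_bounds (t := t) (x := fun i => s i * (c.1 i : ℝ))
      (ρ := ((N : ℝ) + M) / 2) (fun i => by
        rw [e2]
        refine (h4 i).trans ?_
        have := ht0 i
        gcongr
        linarith)).2
    rw [e1] at hl1
    rw [e2] at hl2
    have p1 : ∏ i, ((N : ℝ) / t i + (-(M : ℝ) / t i - 1)) = ∏ i, (((N : ℝ) - M) / t i - 1) :=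
      Finset.prod_congr rfl fun i _ => by ring
    have p2 : ∏ i, ((N : ℝ) / t i + ((M : ℝ) / t i + 1)) = ∏ i, (((N : ℝ) + M) / t i + 1) :=
      Finset.prod_congr rfl fun i _ => by ring
    have hb : (0 : ℝ) < (boxFinset s N c).card := by exact_mod_cast card_boxFinset_pos hs h2 c
    have hpos : 0 < ∏ i, ((N : ℝ) / s i + -1) :=
      Finset.prod_pos fun i _ => by linarith [hs1 i]
    have hpos' : 0 < ∏ i, ((N : ℝ) / s i + 1) :=
      Finset.prod_pos fun i _ => by linarith [hs1 i]
    have hnn : 0 ≤ ∏ i, (((N : ℝ) - M) / t i - 1) :=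
      Finset.prod_nonneg fun i _ => by linarith [h4 i]
    rw [encard_box hs h2, p1, p2, div_div, div_div, ← ENNReal.ofReal_natCast]
    constructor
    · rw [ENNReal.ofReal_div_of_pos (by positivity)]
      exact ENNReal.div_le_div ((ENNReal.ofReal_le_ofReal hl1).trans hc1')
        (ENNReal.ofReal_le_ofReal hcb.2)
    · rw [ENNReal.ofReal_div_of_pos (by positivity)]
      refine ENNReal.div_le_div (hc2'.trans (ENNReal.ofReal_le_ofReal hl2))
        (ENNReal.ofReal_le_ofReal ?_)
      simpa only [sub_eq_add_neg] using hcb.1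
  have hlo' := (ENNReal.continuous_ofReal.tendsto W).comp hlo
  have hhi' := (ENNReal.continuous_ofReal.tendsto W).comp hhi
  -- Both bounds are independent of the centre and tend to `W`, so infimum and supremum are squeezed
  -- to the same limit.
  have hinf : lowerDensity s (fun i : Set.range k => a i) = ENNReal.ofReal W := by
    refine (tendsto_of_tendsto_of_tendsto_of_le_of_le' hlo' hhi' ?_ ?_).liminf_eq
    · filter_upwards [hbd] with N h
      exact le_iInf fun c => (h c).1
    · filter_upwards [hbd] with N h
      exact (iInf_le _ 0).trans (h 0).2
  have hsup : upperDensity s (fun i : Set.range k => a i) = ENNReal.ofReal W := by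
    refine (tendsto_of_tendsto_of_tendsto_of_le_of_le' hlo' hhi' ?_ ?_).limsup_eq
    · filter_upwards [hbd] with N h
      exact (h 0).1.trans (le_iSup (fun j => ((preBox s (fun i : Set.range k => a i) N j).encard :
        ℝ≥0∞) / ((box s N j).encard : ℝ≥0∞)) 0)
    · filter_upwards [hbd] with N h
      exact iSup_le fun c => (h c).2
  refine ⟨Set.range k, by rintro _ ⟨q, rfl⟩; exact hkJ q, hsup.trans hinf.symm, ?_, ?_⟩
  · rw [hinf]
    exact ENNReal.ofReal_pos.mpr hW0
  · rintro _ ⟨q, rfl⟩ _ ⟨q', rfl⟩ hne hmem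
    obtain ⟨i, hi⟩ := hsep q q' fun h => hne (congrArg k h)
    exact hi.not_ge (hTR _ hmem i)

/-- By the lower frame bound, a vector orthogonal to every `f i` is zero. -/
theorem IsFrameForWith.closedSpan_eq_top {f : I → H} {A B : ℝ} (hf : IsFrameForWith 𝕜 ⊤ f A B) :
    closedSpan 𝕜 f = ⊤ := by
  rw [closedSpan, Submodule.topologicalClosure_eq_top_iff, Submodule.eq_bot_iff]
  intro x hx
  have h0 : ∀ i, inner 𝕜 (f i) x = 0 := fun i =>
    Submodule.inner_right_of_mem_orthogonal (Submodule.subset_span (Set.mem_range_self i)) hx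
  have h1 := (hf.2.2.2 x trivial).2.1
  simp only [h0, norm_zero, ne_eq, OfNat.ofNat_ne_zero, not_false_eq_true, zero_pow,
    tsum_zero] at h1
  have h2 : ‖x‖ ^ 2 ≤ 0 := by
    by_contra! h
    linarith [mul_pos hf.1 h]
  simpa using le_antisymm h2 (by positivity)

/-- If `M⁺(F) < α < 1`, a set of uniform positive density inside `{i : ⟨fᵢ, f̃ᵢ⟩ ≤ α}` can be removed. -/
theorem exists_removable_subset {s : Fin d → ℝ} (hs : ∀ i, 0 < s i) {a : I → RefGroup d e n}
    {f : I → H} {A B : ℝ} (hf : IsFrameForWith 𝕜 ⊤ f A B)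
    (hlow : 0 < lowerDensity s a) (hup : upperDensity s a < ⊤) (hloc : IsL1LocalizedDual 𝕜 a f)
    {α : ℝ} (h : upperMeasure 𝕜 s a f < ENNReal.ofReal α) {ε : ℝ} (hε : 0 < ε)
    (hεα : ε < 1 - α) :
    ∃ J : Set I, J ⊆ {i | dualDiag 𝕜 f i ≤ α} ∧
      upperDensity s (fun i : J => a i) = lowerDensity s (fun i : J => a i) ∧
      0 < lowerDensity s (fun i : J => a i) ∧
      IsFrameForWith 𝕜 (closedSpan 𝕜 f) (fun i : (Jᶜ : Set I) => f i) (A * (1 - α - ε)) B := by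
  classical
  have hα : 0 < α := ENNReal.ofReal_pos.mp (bot_le.trans_lt h)
  obtain ⟨r, hr, hfr⟩ := hloc
  obtain ⟨M, hM, hdense⟩ := exists_forall_dualDiag_le hs hf hlow hup h
  obtain ⟨T, hT⟩ := summable_iff_vanishing_norm.mp hr.norm ε hε
  -- Avoiding the difference `0` as well makes `a` injective on `J`, so each row or column sum runs
  -- over distinct arguments of `r`, all outside `T`.
  obtain ⟨J, hJα, hJ1, hJ2, hsep⟩ := exists_sparse_subset (J₀ := {i | dualDiag 𝕜 f i ≤ α}) hs hM
    hdense (insert 0 T)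
  refine ⟨J, hJα, hJ1, hJ2, ?_⟩
  rw [hf.closedSpan_eq_top, sub_sub]
  have hinj : ∀ i ∈ J, ∀ j ∈ J, a i = a j → i = j := fun i hi j hj hij => by
    by_contra hne
    exact hsep i hi j hj hne (by simp [hij])
  have hsum : ∀ (F : Finset I) (g : I → RefGroup d e n), Set.InjOn g F → (∀ i ∈ F, g i ∉ T) →
      ∑ i ∈ F, ‖r (g i)‖ ≤ ε := fun F g hg hgT => by
    have h1 := hT (F.image g) (Finset.disjoint_left.mpr fun x hx => by
      obtain ⟨i, hi, rfl⟩ := Finset.mem_image.mp hx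
      exact hgT i hi)
    rw [Finset.sum_image hg] at h1
    exact (le_abs_self _).trans h1.le
  refine hf.compl_of_offDiag_le (by linarith) (by linarith) (fun i hi => hJα hi)
    (fun i j => ‖r (a i - a j)‖) (fun i j => (hfr i j).trans (le_abs_self _))
    (fun F i hF hi hiF => ?_) fun F j hF hj hjF => ?_
  · refine hsum F _ (fun j hj j' hj' hjj => hinj j (hF hj) j' (hF hj') (sub_right_injective hjj))
      fun j hj hjT => ?_
    exact hsep i hi j (hF hj) (fun hij => hiF (hij ▸ hj)) (Finset.mem_insert_of_mem hjT)
  · refine hsum F _ (fun j hj j' hj' hjj => hinj j (hF hj) j' (hF hj') (sub_left_injective hjj))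
      fun i hi hiT => ?_
    exact hsep i (hF hi) j hj (fun hij => hjF (hij ▸ hi)) (Finset.mem_insert_of_mem hiT)

end Density

end FrameDensity
theorem corollary3p8 {𝕜 : Type*} [RCLike 𝕜] {H : Type*} [NormedAddCommGroup H]
    [InnerProductSpace 𝕜 H] [CompleteSpace H] {I : Type*}
    {d e : ℕ} (hd : 0 < d) {n : Fin e → ℕ} (hn : ∀ k, 0 < n k)
    (s : Fin d → ℝ) (hs : ∀ i, 0 < s i)
    (a : I → FrameDensity.RefGroup d e n)
    (f : I → H) (E : FrameDensity.RefGroup d e n → H) (A B : ℝ)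
    (hf : FrameDensity.IsFrameForWith 𝕜 ⊤ f A B)
    (hE : FrameDensity.IsFrameFor 𝕜 ⊤ E)
    (hDlow : 0 < FrameDensity.lowerDensity s a)
    (hDup : FrameDensity.upperDensity s a < ⊤)
    (hloc : FrameDensity.IsL1LocalizedDual 𝕜 a f)
    (hcol : FrameDensity.HasL2ColumnDecay 𝕜 s a f E)
    (hrow : FrameDensity.HasL2RowDecay 𝕜 s a f E) :
    -- for a Riesz basis `E`, the hypothesis `M⁺(E) < D⁻(I, a)` reads `D⁻(I, a) > 1`
    (FrameDensity.IsRieszBasis 𝕜 E →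
      (FrameDensity.upperMeasure 𝕜 s id E < FrameDensity.lowerDensity s a ↔
        1 < FrameDensity.lowerDensity s a)) ∧
    (FrameDensity.upperMeasure 𝕜 s id E < FrameDensity.lowerDensity s a →
      FrameDensity.upperMeasure 𝕜 s a f < 1 ∧
      (∃ J : Set I,
        FrameDensity.upperDensity s (fun i : J => a i) =
          FrameDensity.lowerDensity s (fun i : J => a i) ∧
        0 < FrameDensity.lowerDensity s (fun i : J => a i) ∧
        FrameDensity.IsFrameFor 𝕜 (FrameDensity.closedSpan 𝕜 f)
          (fun i : (Jᶜ : Set I) => f i)) ∧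
      (∀ α : ℝ, FrameDensity.upperMeasure 𝕜 s a f < ENNReal.ofReal α → α < 1 →
        ∀ ε : ℝ, 0 < ε → ε < 1 - α →
          ∃ J : Set I, J ⊆ {i | FrameDensity.dualDiag 𝕜 f i ≤ α} ∧
            FrameDensity.upperDensity s (fun i : J => a i) =
              FrameDensity.lowerDensity s (fun i : J => a i) ∧
            0 < FrameDensity.lowerDensity s (fun i : J => a i) ∧
            FrameDensity.IsFrameForWith 𝕜 (FrameDensity.closedSpan 𝕜 f)
              (fun i : (Jᶜ : Set I) => f i) (A * (1 - α - ε)) B)) := by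
  have : ∀ k, NeZero (n k) := fun k => ⟨(hn k).ne'⟩
  obtain ⟨A', B', hE⟩ := hE
  refine ⟨fun hR => ?_, fun h => ?_⟩
  · rw [FrameDensity.upperMeasure_eq_one hs (hR.dualDiag_eq_one hE)]
  · have hlt := FrameDensity.upperMeasure_lt_one hs hf hE hDup hcol hrow h
    refine ⟨hlt, ?_, fun α hα _ ε hε hεα =>
      FrameDensity.exists_removable_subset hs hf hDlow hDup hloc hα hε hεα⟩
    obtain ⟨b, hb1, hb2⟩ := ENNReal.lt_iff_exists_nnreal_btwn.mp hlt
    have hb : (b : ℝ) < 1 := by exact_mod_cast hb2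
    rw [← ENNReal.ofReal_coe_nnreal] at hb1
    -- Any `b` with `M⁺(F) < b < 1` serves as `α`; half of the gap `1 - b` is spent on `ε`.
    obtain ⟨J, -, h1, h2, h3⟩ := FrameDensity.exists_removable_subset hs hf hDlow hDup hloc hb1
      (ε := (1 - b) / 2) (by linarith) (by linarith)
    exact ⟨J, h1, h2, _, _, h3⟩
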